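/- **Setting.** A transmitter harvests the energy $e_i>0$ at the instants $0=\tau_0<\tau_1<\dots$ with $\tau_i\to\infty$. Put $E(t^-)=\sum_{\tau_i<t}e_i$ and $E(\tau_n)=\sum_{i\le n}e_i$. The receiver can be on for a total time $\Gamma_0>0$, all of it available from time $0$, and $B_0>0$ bits have to be sent. With power $p$ at the transmitter and the receiver on, bits are sent at rate $g(p)$, where $g:[0,\infty)\to\mathbb R$ is strictly increasing and strictly concave, $g(0)=0$, $g(x)\to\infty$ as $x\to\infty$, and $g(x)/x$ is convex and strictly decreasing on $(0,\infty)$ with limit $0$ at infinity. For $\mathcal{B}>0$ and $E>0$, the time $d>0$ *needed to send $\mathcal{B}$ bits with the energy $E$* is the solution of $d\,g(E/d)=\mathcal{B}$. A policy uses constant powers $p_i\ge0$ on consecutive intervals $[s_i,s_{i+1}]$, $1\le i\le N$, with $0\le s_1<\dots<s_{N+1}$; the receiver is on exactly while the power is nonzero. Let $U(t)$, $B(t)$, $O(t)$ be the energy used, the bits sent, and the on-time of the receiver up to time $t$. The policy is feasible if, with $T=s_{N+1}$, $B(T)=B_0$ and $U(t)\le E(t^-)$, $O(t)\le\Gamma_0$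 for all $t\in[0,T]$. It is optimal if it is feasible and its finish time $T$ is the least among all feasible policies. **Algorithm OFF.** *INIT_POLICY.* Let $\tau_n$ be the first instant with $\Gamma_0\,g(E(\tau_n)/\Gamma_0)\ge B_0$; solve $\widetilde\Gamma_0\,g(E(\tau_n)/\widetilde\Gamma_0)=B_0$ for $\widetilde\Gamma_0>0$, and put $p_c=E(\tau_n)/\widetilde\Gamma_0$. Let $T_{start}\ge0$ be the earliest time from which power $p_c$ can be used for a time $\widetilde\Gamma_0$ without violating the energy constraint, put $T_{stop}=T_{start}+\widetilde\Gamma_0$, and let $\tau_q$ be the first instant in $[T_{start},T_{stop}]$ with $U(\tau_q)=E(\tau_q^-)$. If $U(T_{stop})=E(T_{stop}^-)$, return this constant-power policy. Otherwise use $p_c$ from $T_{start}$ to $\tau_q$, and from $\tau_q$ on use the following algorithm (of Yang and Ulukus, without receiver constraint) to send the remaining $(T_{stop}-\tau_q)g(p_c)$ bits. To send $\mathcal{B}$ bits from $\tau_k$ on, put $E_i=E(\tau_i^-)-E(\tau_k^-)$ for $i>k$, and let $m>k$ be the least index with $(\tau_m-\tau_k)\,g(E_m/(\tau_m-\tau_k))\ge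 \mathcal{B}$; let $\tilde p$ be the constant power with which the energy $E_m$ sends $\mathcal{B}$ bits. If $\tilde p\le E_i/(\tau_i-\tau_k)$ for all $k<i<m$, use $\tilde p$ until $\mathcal{B}$ bits are sent, and stop. Otherwise choose $k<j<m$ where $E_j/(\tau_j-\tau_k)$ is least, use this power up to $\tau_j$, and repeat from $\tau_j$ for the remaining bits. *PULL_BACK.* For the current policy with start $T_{start}$ and end $T_{stop}$: if $T_{stop}-T_{start}\ge\Gamma_0$ or $T_{start}=0$, terminate. Otherwise let $\tau_l$ and $\tau_r$ be the first and the last instant in $(T_{start},T_{stop})$ with $U(\tau)=E(\tau^-)$, and make one iteration, which changes only the powers before $\tau_l$ and after $\tau_r$. 1. If there is an arrival in $(\tau_r,T_{stop})$, let $p_r'$ be the greatest power such that using the energy $E(T_{stop}^-)-E(\tau_r^-)$ at power $p_r'$ from $\tau_r$ on obeys the energy constraint, and let $T_{stop}'$ be the time at which that energy is used up. If there is no such arrival, remove the part after $\tau_r$, so that $T_{stop}'=\tau_r$. In both cases let $p_l'$ be the power such that using the energy $E(\tau_l^-)$ at constant power $p_l'$ right before $\tau_l$ keeps the total number of bits unchanged.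 2. If $p_l'$ exists and is feasible (that is, $T_{start}'=\tau_l-E(\tau_l^-)/p_l'\ge0$ and the energy constraint holds up to $\tau_l$), accept these changes. Otherwise discard the changes after $\tau_r$; let $p_l'$ be the least feasible first power, put $T_{start}'=\tau_l-E(\tau_l^-)/p_l'$, and let $p_r'$ be the power such that using the energy $E(T_{stop}^-)-E(\tau_r^-)$ at constant power $p_r'$ from $\tau_r$ on keeps the total number of bits unchanged; $T_{stop}'$ is the time at which that energy is used up. Then repeat PULL_BACK with the new policy. *QUIT.* If the final policy of PULL_BACK has duration at most $\Gamma_0$, output it. Otherwise let $T_{start},T_{stop},\tau_l,\tau_r$ belong to the policy before the last iteration and $T_{start}',T_{stop}'$ to the policy after it. Find $x\in[T_{start}',T_{start}]$ and $y\in[T_{stop}',T_{stop}]$ with $y-x=\Gamma_0$ such that the number of bits sent before $\tau_l$ and after $\tau_r$ by the policy before the last iteration equals $$(\tau_l-x)\,g\!\left(\frac{E(\tau_l^-)}{\tau_l-x}\right)+(y-\tau_r)\,g\!\left(\frac{E(T_{stop}^-)-E(\tau_r^-)}{y-\tau_r}\right),$$ and output the policy that starts at $x$, ends at $y$, uses the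 two constant powers in this formula before $\tau_l$ and after $\tau_r$, and agrees with the policy before the last iteration between $\tau_l$ and $\tau_r$. **Theorem.** If the problem has a feasible policy, then INIT_POLICY has an output, and OFF, run from any output of INIT_POLICY, always terminates after finitely many steps, never gets stuck, and outputs an optimal policy. -/

import Mathlib

open Set Filter Topology

noncomputable section

namespace EnergyHarvest

/-- The assumptions on the rate function: `g p` is the number of bits per unit of time that are
transmitted with power `p ≥ 0` while the receiver is on. -/
structure IsRateFunction (g : ℝ → ℝ) : Prop where
  map_zero : g 0 = 0
  strictMono : StrictMonoOn g (Ici 0)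
  tendsto_atTop : Tendsto g atTop atTop
  strictConcave : StrictConcaveOn ℝ (Ici 0) g
  ratio_convex : ConvexOn ℝ (Ioi 0) (fun x => g x / x)
  ratio_strictAnti : StrictAntiOn (fun x => g x / x) (Ioi 0)
  ratio_tendsto : Tendsto (fun x => g x / x) atTop (𝓝 0)

/-- The data of the problem: the transmitter harvests the energy `e i` at the instant `τ i`,
the receiver can be on for a total time `Γ₀` (harvested at time `0`), and `B₀` bits have to be
sent at the rate given by `g`. -/
structure System where
  τ : ℕ → ℝ
  e : ℕ → ℝ
  g : ℝ → ℝ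
  Γ₀ : ℝ
  B₀ : ℝ
  τ_zero : τ 0 = 0
  τ_strictMono : StrictMono τ
  τ_tendsto : Tendsto τ atTop atTop
  e_pos : ∀ i, 0 < e i
  rate : IsRateFunction g
  Γ₀_pos : 0 < Γ₀
  B₀_pos : 0 < B₀

/-- A transmission policy: the power `p i` is used from `s i` to `s (i + 1)`, for `i < N`.
The receiver is on exactly while the power is nonzero. -/
structure Policy where
  N : ℕ
  s : ℕ → ℝ
  p : ℕ → ℝ
  s_zero_nonneg : 0 ≤ s 0
  s_lt : ∀ i < N, s i < s (i + 1)
  p_nonneg : ∀ i < N, 0 ≤ p i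

namespace Policy

variable (P : Policy)

/-- The time at which the policy starts. -/
def start : ℝ := P.s 0

/-- The time at which the policy ends. -/
def finish : ℝ := P.s P.N

/-- The duration of the policy. -/
def duration : ℝ := P.finish - P.start

/-- The transmission power at time `t`. -/
def power (t : ℝ) : ℝ :=
  ∑ i ∈ Finset.range P.N, if P.s i ≤ t ∧ t < P.s (i + 1) then P.p i else 0

/-- `U(t)`: the energy used by the transmitter up to time `t`. -/
def energyUsed (t : ℝ) : ℝ :=
  ∑ i ∈ Finset.range P.N, P.p i * (min t (P.s (i + 1)) - min t (P.s i))

/-- `B(t)`: the number of bits sent up to time `t`. -/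
def bits (g : ℝ → ℝ) (t : ℝ) : ℝ :=
  ∑ i ∈ Finset.range P.N, g (P.p i) * (min t (P.s (i + 1)) - min t (P.s i))

open Classical in
/-- `O(t)`: the total time for which the receiver is on up to time `t`. -/
def onTime (t : ℝ) : ℝ :=
  ∑ i ∈ Finset.range P.N, if P.p i = 0 then 0 else min t (P.s (i + 1)) - min t (P.s i)

end Policy

namespace System

variable (S : System)

/-- `E(t⁻)`: the energy harvested at the transmitter strictly before time `t`. -/
def harvestedBefore (t : ℝ) : ℝ := ∑' i, if S.τ i < t then S.e i else 0

/-- `E(τ n)`: the energy harvested at the transmitter up to and including the instant `τ n`. -/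
def harvestedUpTo (n : ℕ) : ℝ := ∑ i ∈ Finset.range (n + 1), S.e i

/-! ### The optimization problem -/

/-- The constraints of the problem: all bits are sent, and the energy constraint of the
transmitter and the on-time constraint of the receiver hold at all times. -/
structure IsFeasible (P : Policy) : Prop where
  bits_eq : P.bits S.g P.finish = S.B₀
  energy : ∀ t ∈ Icc 0 P.finish, P.energyUsed t ≤ S.harvestedBefore t
  receiver : ∀ t ∈ Icc 0 P.finish, P.onTime t ≤ S.Γ₀

/-- Optimality: the policy is feasible and has the least finish time of all feasible policies. -/
def IsOptimal (P : Policy) : Prop :=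
  S.IsFeasible P ∧ ∀ Q : Policy, S.IsFeasible Q → P.finish ≤ Q.finish

/-! ### Auxiliary notions of the algorithm -/

/-- The number of bits sent when the energy `E` is used at constant power for a time `d`. -/
def burst (E d : ℝ) : ℝ := d * S.g (E / d)

/-- Transmission at constant power `p` from `a` to `b`, when the energy used before `a` is `u`,
obeys the energy constraint. -/
def LineFeasible (a b u p : ℝ) : Prop :=
  ∀ t ∈ Icc a b, u + p * (t - a) ≤ S.harvestedBefore t

/-- The instants `τ i`, strictly between the start and the end of the policy, at which all
the energy harvested before has been used. -/
def touching (P : Policy) : Set ℕ :=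
  {i | P.start < S.τ i ∧ S.τ i < P.finish ∧ P.energyUsed (S.τ i) = S.harvestedBefore (S.τ i)}

/-! ### The algorithm for a transmitter without receiver constraint -/

/-- The algorithm of Yang and Ulukus (minimal finish time, no receiver constraint), run from the
instant `τ k`, at which no energy is left from before, for sending `B` bits.
`MinTime k B T w` says that it ends at time `T` and that its power at time `t ∈ [τ k, T)` is `w t`.

* `m` is the first instant by which `B` bits could be sent with all energy harvested before, if the
  causality of the harvests were ignored; `E` is that energy, and `d` is the time that it takes
  to send `B` bits with it at constant power.
* If that constant power is at most the average harvesting rate up to each of the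
  instants before `τ m`, it is used until the end.
* Otherwise the smallest of these rates is used up to the instant `τ j` where it occurs, and
  the algorithm is run again from `τ j` for the remaining bits. -/
inductive MinTime : ℕ → ℝ → ℝ → (ℝ → ℝ) → Prop
  | last (k m : ℕ) (B E d : ℝ)
      (hm : IsLeast {i | k < i ∧ B ≤ S.burst
        (S.harvestedBefore (S.τ i) - S.harvestedBefore (S.τ k)) (S.τ i - S.τ k)} m)
      (hE : E = S.harvestedBefore (S.τ m) - S.harvestedBefore (S.τ k))
      (hd : 0 < d) (hB : S.burst E d = B)
      (hle : ∀ i, k < i → i < m →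
        E / d ≤ (S.harvestedBefore (S.τ i) - S.harvestedBefore (S.τ k)) / (S.τ i - S.τ k)) :
      MinTime k B (S.τ k + d) (fun _ => E / d)
  | step (k m j : ℕ) (B E d r T : ℝ) (w : ℝ → ℝ)
      (hm : IsLeast {i | k < i ∧ B ≤ S.burst
        (S.harvestedBefore (S.τ i) - S.harvestedBefore (S.τ k)) (S.τ i - S.τ k)} m)
      (hE : E = S.harvestedBefore (S.τ m) - S.harvestedBefore (S.τ k))
      (hd : 0 < d) (hB : S.burst E d = B)
      (hkj : k < j) (hjm : j < m)
      (hr : r = (S.harvestedBefore (S.τ j) - S.harvestedBefore (S.τ k)) / (S.τ j - S.τ k))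
      (hmin : ∀ i, k < i → i < m →
        r ≤ (S.harvestedBefore (S.τ i) - S.harvestedBefore (S.τ k)) / (S.τ i - S.τ k))
      (hlt : r < E / d)
      (hrec : MinTime j (B - S.g r * (S.τ j - S.τ k)) T w) :
      MinTime k B T (fun t => if t < S.τ j then r else w t)

/-! ### INIT_POLICY -/

/-- `P` is an output of INIT_POLICY. Here `τ n` is the first instant such that the energy harvested
up to then suffices, `d` is the time needed with that energy, `a` is the earliest feasible start
with the constant power `pc`, and `τ q` is the first instant at which this transmission has
used all the energy harvested before. -/
def IsInit (P : Policy) : Prop :=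
  ∃ (n q : ℕ) (d pc a : ℝ),
    IsLeast {i | S.B₀ ≤ S.burst (S.harvestedUpTo i) S.Γ₀} n ∧
    0 < d ∧ S.burst (S.harvestedUpTo n) d = S.B₀ ∧
    pc = S.harvestedUpTo n / d ∧
    IsLeast {t | 0 ≤ t ∧ S.LineFeasible t (t + d) 0 pc} a ∧
    IsLeast {i | S.τ i ∈ Icc a (a + d) ∧ pc * (S.τ i - a) = S.harvestedBefore (S.τ i)} q ∧
    P.start = a ∧
    ((pc * d = S.harvestedBefore (a + d) ∧ P.finish = a + d ∧
        ∀ t ∈ Ico a (a + d), P.power t = pc) ∨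
      (pc * d < S.harvestedBefore (a + d) ∧
        ∃ (T : ℝ) (w : ℝ → ℝ), S.MinTime q ((a + d - S.τ q) * S.g pc) T w ∧ P.finish = T ∧
          ∀ t ∈ Ico a T, P.power t = if t < S.τ q then pc else w t))

/-! ### PULL_BACK -/

/-- `Q` starts at `a` with power `pl` up to `τ l`, coincides with `P` from `τ l` to `τ r`,
and has power `pr` from `τ r` to its end `b`. -/
def IsSplice (P : Policy) (l r : ℕ) (a pl pr b : ℝ) (Q : Policy) : Prop :=
  Q.start = a ∧ Q.finish = b ∧
    ∀ t ∈ Ico a b, Q.power t = if t < S.τ l then pl else if t < S.τ r then P.power t else pr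

/-- The energy used by `P` before `τ l`, when `l` is the first element of `S.touching P`. -/
def leftEnergy (l : ℕ) : ℝ := S.harvestedBefore (S.τ l)

/-- The energy used by `P` after `τ r`, when `r` is the last element of `S.touching P`. -/
def rightEnergy (P : Policy) (r : ℕ) : ℝ :=
  S.harvestedBefore P.finish - S.harvestedBefore (S.τ r)

/-- The number of bits that `P` sends before `τ l` or after `τ r`. -/
def outerBits (P : Policy) (l r : ℕ) : ℝ :=
  P.bits S.g (S.τ l) + (P.bits S.g P.finish - P.bits S.g (S.τ r))

/-- First step of an iteration: the new last power `pr` and the new end `b`.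

* If there is an arrival between `τ r` and the end of `P`, the power after `τ r` is raised
  (always using the same energy) as far as the energy constraint permits.
* Otherwise the power after `τ r` can be raised without bound, and the part after `τ r` is removed:
  the policy now ends at `τ r` with the power that it has just before, and the value of `pr` is
  immaterial (nothing is sent after `τ r`). -/
inductive RaiseLast (P : Policy) (r : ℕ) : ℝ → ℝ → Prop
  | hit (pr : ℝ) (harr : ∃ i, r < i ∧ S.τ i < P.finish)
      (hpr : IsGreatest {p | 0 < p ∧ S.LineFeasible (S.τ r) (S.τ r + S.rightEnergy P r / p)
        (S.harvestedBefore (S.τ r)) p} pr) :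
      RaiseLast P r pr (S.τ r + S.rightEnergy P r / pr)
  | unbounded (harr : ∀ i, r < i → P.finish ≤ S.τ i) :
      RaiseLast P r 0 (S.τ r)

/-- The power `pl` before `τ l`, using the energy harvested before `τ l`, makes up for the change of
the bits sent after `τ r` that is caused by using the power `pr` from `τ r` to `b`. -/
def Compensates (P : Policy) (l r : ℕ) (pl pr b : ℝ) : Prop :=
  S.g pl * (S.leftEnergy l / pl) + S.g pr * (b - S.τ r) = S.outerBits P l r

/-- It is feasible to use all the energy harvested before `τ l` at the constant power `pl`
right before `τ l`. -/
def FirstFeasible (l : ℕ) (pl : ℝ) : Prop :=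
  0 < pl ∧ 0 ≤ S.τ l - S.leftEnergy l / pl ∧
    S.LineFeasible (S.τ l - S.leftEnergy l / pl) (S.τ l) 0 pl

/-- One iteration of PULL_BACK, which turns `P` into `Q`. -/
inductive Iteration (P Q : Policy) : Prop
  /-- The last power is raised, and the compensating first power is feasible. -/
  | accept (l r : ℕ) (pl pr b : ℝ)
      (hl : IsLeast (S.touching P) l) (hr : IsGreatest (S.touching P) r)
      (hraise : S.RaiseLast P r pr b)
      (hcomp : S.Compensates P l r pl pr b) (hfeas : S.FirstFeasible l pl)
      (hQ : S.IsSplice P l r (S.τ l - S.leftEnergy l / pl) pl pr b Q)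
  /-- There is no feasible compensating first power. The change of the last power is discarded, the
  least feasible first power is used, and the last power is the one that compensates. -/
  | reject (l r : ℕ) (pl pr pr₀ b₀ : ℝ)
      (hl : IsLeast (S.touching P) l) (hr : IsGreatest (S.touching P) r)
      (hraise : S.RaiseLast P r pr₀ b₀)
      (hinf : ¬ ∃ p, S.Compensates P l r p pr₀ b₀ ∧ S.FirstFeasible l p)
      (hpl : IsLeast {p | S.FirstFeasible l p} pl)
      (hpr : 0 < pr)
      (hcomp : S.Compensates P l r pl pr (S.τ r + S.rightEnergy P r / pr))
      (hQ : S.IsSplice P l r (S.τ l - S.leftEnergy l / pl) pl pr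
        (S.τ r + S.rightEnergy P r / pr) Q)

/-- The termination condition of PULL_BACK. -/
def Terminated (P : Policy) : Prop := S.Γ₀ ≤ P.duration ∨ P.start = 0

/-! ### QUIT -/

/-- The final correction, when the last iteration has turned `P` into a policy `P'` which is longer
than `Γ₀`: `Q` starts at `x`, ends at `y`, and has duration exactly `Γ₀`. -/
def IsQuit (P P' Q : Policy) : Prop :=
  ∃ (l r : ℕ) (x y : ℝ),
    IsLeast (S.touching P) l ∧ IsGreatest (S.touching P) r ∧
    x ∈ Icc P'.start P.start ∧ y ∈ Icc P'.finish P.finish ∧ S.τ r < y ∧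
    S.burst (S.leftEnergy l) (S.τ l - x) + S.burst (S.rightEnergy P r) (y - S.τ r)
      = S.outerBits P l r ∧
    y - x = S.Γ₀ ∧
    S.IsSplice P l r x (S.leftEnergy l / (S.τ l - x)) (S.rightEnergy P r / (y - S.τ r)) y Q

/-! ### The whole algorithm -/

/-- The states of the algorithm after INIT_POLICY: it is about to test the termination condition
for the current policy, or it has stopped with an output. -/
inductive State
  | running (P : Policy)
  | output (Q : Policy)

/-- The transitions of the algorithm `OFF` after INIT_POLICY. -/
inductive Step : State → State → Prop
  /-- PULL_BACK has terminated with a policy of duration at most `Γ₀`, which is output. -/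
  | accept (P : Policy) (hP : S.Terminated P) (hdur : P.duration ≤ S.Γ₀) :
      Step (.running P) (.output P)
  /-- An iteration of PULL_BACK. -/
  | iterate (P P' : Policy) (hP : ¬ S.Terminated P) (hP' : S.Iteration P P')
      (hdur : P'.duration ≤ S.Γ₀) :
      Step (.running P) (.running P')
  /-- An iteration of PULL_BACK makes the policy longer than `Γ₀`, and QUIT corrects this. -/
  | quit (P P' Q : Policy) (hP : ¬ S.Terminated P) (hP' : S.Iteration P P')
      (hdur : S.Γ₀ < P'.duration) (hQ : S.IsQuit P P' Q) :
      Step (.running P) (.output Q)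

end System

end EnergyHarvest

end

open Set Filter Topology

namespace EnergyHarvest

/-! The proof is Lagrangian duality for a taut-string structure. Call a policy taut (`IsTaut`) if it
sends all bits, obeys the energy constraint, exhausts the harvested energy at its end, and has a
positive nondecreasing power that rises only at arrivals where no energy is left.

At each power `p > 0` the concave rate has a supporting line `μ(p) + ν(p) q`, strictly above `g`
away from `p`, with `ν` antitone and `μ` monotone. Read `ν` as the price of energy and `μ` as the
price of on-time. Along a taut policy the energy price falls only when the battery is empty, where
no feasible competitor can have used more energy. Hence a competitor's bits are bounded by those of
the taut policy plus priced differences of energy and on-time (`IsTaut.bits_le`). If the taut policy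
has an empty battery at some arrival in `[start, finish)` and cannot be on longer (it starts at time
0 or lasts exactly `Γ₀`), a competitor that ends earlier would violate this bound strictly
(`IsTaut.isOptimal`).

It remains to see that the algorithm stays among taut policies of duration at most `Γ₀` and stops.
INIT_POLICY yields a taut policy because the unconstrained algorithm never goes below the power
guaranteed to it (`KeepsRate`, `MinTime.spec`). An iteration of PULL_BACK lowers the first power and
raises or removes the last one while keeping the bits, so the result is still taut
(`HasEnds.splice`, `IsMove.spec`). The minimality of the index `n` of INIT_POLICY ensures that an
arrival with empty battery survives (`IsMove.isCurrent`).

Each iteration removes the tail or creates a new arrival with empty battery outside the old ones, or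
reaches start 0. A natural number therefore decreases as long as the start is positive
(`IsMove.rank_lt`). When an iteration overshoots `Γ₀`, sliding a window of length `Γ₀` between the
two policies and the intermediate value theorem give the output of QUIT (`IsMove.exists_isQuit`),
which is taut with duration exactly `Γ₀`. -/

/-! ### Energy, bits and on-time as integrals over the power -/

theorem intervalIntegrable_ite_Ico (c d v s t : ℝ) :
    IntervalIntegrable (fun x => if c ≤ x ∧ x < d then v else 0) MeasureTheory.volume s t := by
  have h : (fun x => if c ≤ x ∧ x < d then v else 0) = (Ico c d).indicator (fun _ => v) := by
    ext x; simp [indicator, mem_Ico]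
  rw [h, intervalIntegrable_iff]
  exact MeasureTheory.IntegrableOn.indicator (by simp [MeasureTheory.integrableOn_const_iff])
    measurableSet_Ico

theorem integral_ite_Ico {a c d : ℝ} (hac : a ≤ c) (hcd : c ≤ d) (v t : ℝ) :
    ∫ x in a..t, (if c ≤ x ∧ x < d then v else 0) = v * (min t d - min t c) := by
  rcases le_total t a with hta | hat
  · rw [min_eq_left (by linarith), min_eq_left (by linarith), sub_self, mul_zero,
      intervalIntegral.integral_symm, neg_eq_zero,
      intervalIntegral.integral_congr_Ioo_of_le (g := fun _ => 0) hta]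
    · simp
    · intro x hx
      have : ¬ (c ≤ x ∧ x < d) := fun h => by linarith [hx.2, h.1]
      simp [this]
  · have h : (fun x => if c ≤ x ∧ x < d then v else 0) = (Ico c d).indicator (fun _ => v) := by
      ext x; simp [indicator, mem_Ico]
    rw [h, intervalIntegral.integral_of_le hat, ← MeasureTheory.integral_Ico_eq_integral_Ioc,
      MeasureTheory.setIntegral_indicator measurableSet_Ico, Ico_inter_Ico,
      MeasureTheory.setIntegral_const, sup_eq_right.2 hac, smul_eq_mul, mul_comm]
    congr 1
    rw [Real.volume_real_Ico]
    rcases le_total t c with h1 | h1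
    · rw [min_eq_left h1, min_eq_left (h1.trans hcd), sub_self, max_eq_right]
      linarith [min_le_left t d]
    · rw [min_eq_right h1, max_eq_left]
      exact sub_nonneg.2 (le_min h1 hcd)

namespace Policy

variable (P : Policy)

/-- The quantity accumulated up to time `t` when power `p` accumulates `f p` per unit of time. -/
noncomputable def total (f : ℝ → ℝ) (t : ℝ) : ℝ :=
  ∑ i ∈ Finset.range P.N, f (P.p i) * (min t (P.s (i + 1)) - min t (P.s i))

theorem energyUsed_eq_total : P.energyUsed = P.total id := rfl

theorem bits_eq_total (g : ℝ → ℝ) : P.bits g = P.total g := rfl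

open Classical in
theorem onTime_eq_total : P.onTime = P.total (fun p => if p = 0 then 0 else 1) := by
  funext t
  refine Finset.sum_congr rfl fun i _ => ?_
  split_ifs <;> simp_all

theorem s_le_s {i j : ℕ} (hij : i ≤ j) (hj : j ≤ P.N) : P.s i ≤ P.s j := by
  induction j, hij using Nat.le_induction with
  | base => exact le_rfl
  | succ k hk ih => exact (ih (by omega)).trans (P.s_lt k (by omega)).le

theorem start_le_finish : P.start ≤ P.finish := P.s_le_s (Nat.zero_le _) le_rfl

theorem start_nonneg : 0 ≤ P.start := P.s_zero_nonneg

/-- The pieces are disjoint, so at most one summand is nonzero at any time and `f` passes through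
the sum; `f 0 = 0` covers the times off the policy. This makes every accumulated quantity an
integral that depends on the power function alone. -/
theorem apply_power {f : ℝ → ℝ} (hf : f 0 = 0) (t : ℝ) :
    f (P.power t) =
      ∑ i ∈ Finset.range P.N, if P.s i ≤ t ∧ t < P.s (i + 1) then f (P.p i) else 0 := by
  unfold power
  by_cases h : ∃ i < P.N, P.s i ≤ t ∧ t < P.s (i + 1)
  · obtain ⟨i, hi, hit⟩ := h
    have key : ∀ j ∈ Finset.range P.N, j ≠ i → ¬ (P.s j ≤ t ∧ t < P.s (j + 1)) := by
      intro j hj hji hjt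
      have hj' := Finset.mem_range.1 hj
      rcases lt_or_gt_of_ne hji with h | h
      · linarith [P.s_le_s (show j + 1 ≤ i from h) hi.le, hit.1, hjt.2]
      · linarith [P.s_le_s (show i + 1 ≤ j from h) hj'.le, hit.2, hjt.1]
    rw [Finset.sum_eq_single i (fun j hj hji => if_neg (key j hj hji)) (by simp [hi]),
      Finset.sum_eq_single i (fun j hj hji => if_neg (key j hj hji)) (by simp [hi]),
      if_pos hit, if_pos hit]
  · push Not at h
    have key : ∀ j ∈ Finset.range P.N, ¬ (P.s j ≤ t ∧ t < P.s (j + 1)) := fun j hj hjt =>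
      absurd hjt.2 (not_lt.2 (h j (Finset.mem_range.1 hj) hjt.1))
    rw [Finset.sum_eq_zero fun j hj => if_neg (key j hj),
      Finset.sum_eq_zero fun j hj => if_neg (key j hj), hf]

theorem intervalIntegrable_power {f : ℝ → ℝ} (hf : f 0 = 0) (s t : ℝ) :
    IntervalIntegrable (fun x => f (P.power x)) MeasureTheory.volume s t := by
  simp_rw [P.apply_power hf]
  have := IntervalIntegrable.sum (μ := MeasureTheory.volume) (a := s) (b := t)
    (Finset.range P.N) (f := fun i x => if P.s i ≤ x ∧ x < P.s (i + 1) then f (P.p i) else 0)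
    (fun i _ => intervalIntegrable_ite_Ico _ _ _ _ _)
  have h : (fun x => ∑ i ∈ Finset.range P.N,
      if P.s i ≤ x ∧ x < P.s (i + 1) then f (P.p i) else 0) = ∑ i ∈ Finset.range P.N,
      fun x => if P.s i ≤ x ∧ x < P.s (i + 1) then f (P.p i) else 0 := by
    ext x; simp
  rwa [h]

theorem total_eq_integral {f : ℝ → ℝ} (hf : f 0 = 0) (t : ℝ) :
    P.total f t = ∫ x in P.start..t, f (P.power x) := by
  simp_rw [P.apply_power hf]
  rw [intervalIntegral.integral_finsetSum fun i _ => intervalIntegrable_ite_Ico _ _ _ _ _]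
  refine Finset.sum_congr rfl fun i hi => ?_
  have hi' := Finset.mem_range.1 hi
  exact (integral_ite_Ico (P.s_le_s (Nat.zero_le i) hi'.le) (P.s_lt i hi').le _ _).symm

theorem total_sub_total {f : ℝ → ℝ} (hf : f 0 = 0) (s t : ℝ) :
    P.total f t - P.total f s = ∫ x in s..t, f (P.power x) := by
  rw [P.total_eq_integral hf, P.total_eq_integral hf,
    intervalIntegral.integral_interval_sub_left (P.intervalIntegrable_power hf _ _)
      (P.intervalIntegrable_power hf _ _)]

theorem total_of_le_start (f : ℝ → ℝ) {t : ℝ} (ht : t ≤ P.start) : P.total f t = 0 := by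
  refine Finset.sum_eq_zero fun i hi => ?_
  have hi' := Finset.mem_range.1 hi
  have h0 : P.start ≤ P.s i := P.s_le_s (Nat.zero_le i) hi'.le
  rw [min_eq_left (by linarith [P.s_lt i hi']), min_eq_left (by linarith), sub_self, mul_zero]

theorem total_of_finish_le (f : ℝ → ℝ) {t : ℝ} (ht : P.finish ≤ t) :
    P.total f t = P.total f P.finish := by
  refine Finset.sum_congr rfl fun i hi => ?_
  have hi' := Finset.mem_range.1 hi
  have h1 : P.s (i + 1) ≤ P.finish := P.s_le_s hi' le_rfl
  have h0 : P.s i ≤ P.finish := P.s_le_s hi'.le le_rfl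
  rw [min_eq_right (h1.trans ht), min_eq_right (h0.trans ht), min_eq_right h1, min_eq_right h0]

/-- A pointwise inequality between rates is weighted by the time that each piece spends in `[s, t]`.
With a supporting line on the right it becomes the Jensen-type bound behind all comparisons of
policies. -/
theorem total_sub_le {f h k : ℝ → ℝ} {μ ν : ℝ} (hle : ∀ q, 0 ≤ q → f q ≤ μ * h q + ν * k q)
    {s t : ℝ} (hst : s ≤ t) :
    P.total f t - P.total f s ≤
      μ * (P.total h t - P.total h s) + ν * (P.total k t - P.total k s) := by
  simp only [total, ← Finset.sum_sub_distrib, Finset.mul_sum, ← Finset.sum_add_distrib]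
  refine Finset.sum_le_sum fun i hi => ?_
  have hi' := Finset.mem_range.1 hi
  have hs := P.s_lt i hi'
  -- The difference of the two sides is the length of the overlap of the piece with `[s, t]`.
  have hmono : min s (P.s (i + 1)) - min s (P.s i) ≤ min t (P.s (i + 1)) - min t (P.s i) := by
    rcases le_total s (P.s i) with h1 | h1
    · rw [min_eq_left h1, min_eq_left (h1.trans hs.le), sub_self, sub_nonneg]
      exact min_le_min_left _ hs.le
    · rw [min_eq_right h1, min_eq_right (h1.trans hst)]
      exact sub_le_sub_right (min_le_min_right _ hst) _
  have := mul_le_mul_of_nonneg_right (hle _ (P.p_nonneg i hi')) (sub_nonneg.2 hmono)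
  linarith

theorem total_one (t : ℝ) (h0 : P.start ≤ t) :
    P.total (fun _ => 1) t = min t P.finish - P.start := by
  unfold total
  simp only [one_mul]
  rw [Finset.sum_range_sub (fun i => min t (P.s i))]
  congr 1
  exact min_eq_right h0

theorem onTime_sub_le {s t : ℝ} (hst : s ≤ t) : P.onTime t - P.onTime s ≤ t - s := by
  classical
  have h1 := P.total_sub_le (f := fun p => if p = 0 then 0 else 1) (h := fun _ => 1)
    (k := id) (μ := 1) (ν := 0) (fun q _ => by split_ifs <;> simp) hst
  rw [P.onTime_eq_total]
  have hone : P.total (fun _ => 1) t - P.total (fun _ => 1) s ≤ t - s := by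
    have hf := P.start_le_finish
    rcases le_total s P.start with hs | hs
    · rw [P.total_of_le_start _ hs]
      rcases le_total t P.start with ht | ht
      · rw [P.total_of_le_start _ ht]; linarith
      · rw [P.total_one _ ht]; linarith [min_le_left t P.finish]
    · rw [P.total_one _ hs, P.total_one _ (hs.trans hst)]
      rcases le_total s P.finish with h | h
      · rw [min_eq_left h]; linarith [min_le_left t P.finish]
      · rw [min_eq_right h]; linarith [min_le_right t P.finish]
  linarith

theorem onTime_le_duration (t : ℝ) : P.onTime t ≤ P.duration := by
  have h0 : P.onTime P.start = 0 := by rw [onTime_eq_total]; exact P.total_of_le_start _ le_rfl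
  have hf := P.start_le_finish
  rcases le_total t P.start with ht | ht
  · rw [onTime_eq_total, P.total_of_le_start _ ht, duration]; linarith
  rcases le_total t P.finish with h | h
  · have := P.onTime_sub_le ht
    rw [duration]; linarith
  · have := P.onTime_sub_le hf
    rw [onTime_eq_total, P.total_of_finish_le _ h, ← onTime_eq_total, duration]; linarith

/-- A bound on the bits sent by means of a line above the rate function. -/
theorem bits_sub_le {g : ℝ → ℝ} (hg : g 0 = 0) {μ ν : ℝ} (hle : ∀ q, 0 ≤ q → g q ≤ μ + ν * q)
    {s t : ℝ} (hst : s ≤ t) :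
    P.bits g t - P.bits g s ≤
      μ * (P.onTime t - P.onTime s) + ν * (P.energyUsed t - P.energyUsed s) := by
  classical
  rw [onTime_eq_total, energyUsed_eq_total, bits_eq_total]
  refine P.total_sub_le (fun q hq => ?_) hst
  -- At zero power the receiver is off and the intercept is not charged; `g 0 = 0` makes up for it.
  by_cases h : q = 0
  · simp [h, hg]
  · simpa [h] using hle q hq

theorem total_sub_of_const {f : ℝ → ℝ} (hf : f 0 = 0) {s t p : ℝ} (hst : s ≤ t)
    (hp : ∀ x ∈ Ico s t, P.power x = p) : P.total f t - P.total f s = f p * (t - s) := by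
  rw [P.total_sub_total hf,
    intervalIntegral.integral_congr_Ioo_of_le (g := fun _ => f p) hst]
  · simp [mul_comm]
  · intro x hx
    simp only [hp x ⟨hx.1.le, hx.2⟩]

theorem total_sub_congr {f : ℝ → ℝ} (hf : f 0 = 0) {Q : Policy} {s t : ℝ} (hst : s ≤ t)
    (hp : ∀ x ∈ Ico s t, Q.power x = P.power x) :
    Q.total f t - Q.total f s = P.total f t - P.total f s := by
  rw [P.total_sub_total hf, Q.total_sub_total hf]
  refine intervalIntegral.integral_congr_Ioo_of_le hst fun x hx => ?_
  simp only [hp x ⟨hx.1.le, hx.2⟩]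

theorem energyUsed_sub_of_const {s t p : ℝ} (hst : s ≤ t) (hp : ∀ x ∈ Ico s t, P.power x = p) :
    P.energyUsed t - P.energyUsed s = p * (t - s) :=
  P.total_sub_of_const (f := id) rfl hst hp

theorem bits_sub_of_const {g : ℝ → ℝ} (hg : g 0 = 0) {s t p : ℝ} (hst : s ≤ t)
    (hp : ∀ x ∈ Ico s t, P.power x = p) : P.bits g t - P.bits g s = g p * (t - s) :=
  P.total_sub_of_const hg hst hp

theorem energyUsed_of_le_start {t : ℝ} (ht : t ≤ P.start) : P.energyUsed t = 0 :=
  P.total_of_le_start id ht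

theorem bits_of_le_start (g : ℝ → ℝ) {t : ℝ} (ht : t ≤ P.start) : P.bits g t = 0 :=
  P.total_of_le_start g ht

end Policy

/-! ### Power functions realised by policies -/

/-- The function `w` is the power of some policy from `a` to `b`. -/
def IsPower (a b : ℝ) (w : ℝ → ℝ) : Prop :=
  ∃ P : Policy, P.start = a ∧ P.finish = b ∧ ∀ t ∈ Ico a b, P.power t = w t

namespace IsPower

theorem congr {a b : ℝ} {w v : ℝ → ℝ} (h : IsPower a b w) (hv : ∀ t ∈ Ico a b, w t = v t) :
    IsPower a b v := by
  obtain ⟨P, h1, h2, h3⟩ := h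
  exact ⟨P, h1, h2, fun t ht => (h3 t ht).trans (hv t ht)⟩

theorem empty {a b : ℝ} (ha : 0 ≤ a) (hab : a = b) (w : ℝ → ℝ) : IsPower a b w :=
  ⟨⟨0, fun _ => a, fun _ => 0, ha, by simp, by simp⟩, rfl, hab, by simp [hab]⟩

theorem snoc {a b c v : ℝ} {w : ℝ → ℝ} (h : IsPower a b w) (hbc : b ≤ c) (hv : 0 ≤ v)
    (hw : ∀ t ∈ Ico b c, w t = v) : IsPower a c w := by
  -- Breakpoints of a policy increase strictly, so an empty piece must not be appended.
  rcases hbc.eq_or_lt with rfl | hbc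
  · exact h
  obtain ⟨P, rfl, rfl, h3⟩ := h
  have hlt : ∀ i < P.N + 1,
      (if i ≤ P.N then P.s i else c) < if i + 1 ≤ P.N then P.s (i + 1) else c := by
    intro i hi
    rcases Nat.lt_succ_iff_lt_or_eq.1 hi with h | rfl
    · simpa [h.le, Nat.succ_le_of_lt h] using P.s_lt i h
    · simpa [Policy.finish] using hbc
  have hp : ∀ i < P.N + 1, 0 ≤ if i < P.N then P.p i else v := by
    intro i _
    split_ifs with h
    exacts [P.p_nonneg i h, hv]
  have hs0 : 0 ≤ if 0 ≤ P.N then P.s 0 else c := by simpa using P.s_zero_nonneg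
  refine ⟨⟨P.N + 1, fun i => if i ≤ P.N then P.s i else c,
    fun i => if i < P.N then P.p i else v, hs0, hlt, hp⟩, ?_, ?_, ?_⟩
  · simp [Policy.start]
  · simp [Policy.finish]
  · intro t ht
    have hsum : (∑ i ∈ Finset.range P.N, if (if i ≤ P.N then P.s i else c) ≤ t ∧
        t < (if i + 1 ≤ P.N then P.s (i + 1) else c) then if i < P.N then P.p i else v else 0)
          = P.power t := by
      refine Finset.sum_congr rfl fun i hi => ?_
      have hi' := Finset.mem_range.1 hi
      simp [hi', hi'.le, Nat.succ_le_of_lt hi']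
    simp only [Policy.power]
    rw [Finset.sum_range_succ, hsum]
    rcases lt_or_ge t P.finish with h | h
    · rw [if_neg, add_zero, h3 t ⟨ht.1, h⟩]
      have h2 : ¬ P.s P.N ≤ t := not_le.2 h
      simp [h2]
    · have h0 : P.power t = 0 := by
        refine Finset.sum_eq_zero fun i hi => if_neg fun h' => ?_
        have := P.s_le_s (show i + 1 ≤ P.N from Finset.mem_range.1 hi) le_rfl
        exact absurd (h'.2.trans_le this) (not_lt.2 h)
      have h1 : P.s P.N ≤ t := h
      simp [h0, h1, ht.2, hw t ⟨h, ht.2⟩]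

theorem const {a b v : ℝ} (ha : 0 ≤ a) (hab : a ≤ b) (hv : 0 ≤ v) : IsPower a b fun _ => v :=
  (empty ha rfl _).snoc hab hv fun _ _ => rfl

theorem nonneg {a b : ℝ} {w : ℝ → ℝ} (h : IsPower a b w) : 0 ≤ a ∧ a ≤ b := by
  obtain ⟨P, rfl, rfl, -⟩ := h
  exact ⟨P.start_nonneg, P.start_le_finish⟩

/-- Induction on the number of constant pieces of a policy. -/
theorem induction {C : ℝ → ℝ → (ℝ → ℝ) → Prop} (h0 : ∀ a w, 0 ≤ a → C a a w)
    (h1 : ∀ a b c v w, IsPower a b w → b ≤ c → 0 ≤ v → (∀ t ∈ Ico b c, w t = v) →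
      C a b w → C a c w)
    {a b : ℝ} {w : ℝ → ℝ} (h : IsPower a b w) : C a b w := by
  obtain ⟨P, rfl, rfl, h3⟩ := h
  obtain ⟨n, hn⟩ : ∃ n, P.N = n := ⟨_, rfl⟩
  induction n generalizing P with
  | zero =>
    rw [Policy.finish, hn]
    exact h0 _ _ P.start_nonneg
  | succ k ih =>
    let Q : Policy := ⟨k, P.s, P.p, P.s_zero_nonneg, fun i hi => P.s_lt i (by omega),
      fun i hi => P.p_nonneg i (by omega)⟩
    have hfin : P.finish = P.s (k + 1) := by rw [Policy.finish, hn]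
    have hlt := P.s_lt k (by omega)
    have hsplit : ∀ t, P.power t
        = Q.power t + if P.s k ≤ t ∧ t < P.s (k + 1) then P.p k else 0 := by
      intro t
      rw [Policy.power, hn, Finset.sum_range_succ]
      rfl
    have hQ : ∀ t ∈ Ico Q.start Q.finish, Q.power t = w t := by
      intro t ht
      have ht2 : t < P.s k := ht.2
      rw [← h3 t ⟨ht.1, by rw [hfin]; linarith⟩, hsplit, if_neg fun h => absurd ht2 (not_lt.2 h.1),
        add_zero]
    have hQk : Q.finish = P.s k := rfl
    rw [hfin]
    refine h1 _ (P.s k) _ (P.p k) _ ⟨Q, rfl, rfl, hQ⟩ hlt.le (P.p_nonneg k (by omega)) ?_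
      (ih Q hQ rfl)
    intro t ht
    have hst : P.start ≤ t := (P.s_le_s (Nat.zero_le k) (by omega)).trans ht.1
    rw [← h3 t ⟨hst, by rw [hfin]; exact ht.2⟩, hsplit, if_pos (mem_Ico.1 ht)]
    have : Q.power t = 0 := by
      refine Finset.sum_eq_zero fun i hi => if_neg fun h' => ?_
      have := P.s_le_s (show i + 1 ≤ k from Finset.mem_range.1 hi) (by omega)
      exact absurd (h'.2.trans_le this) (not_lt.2 ht.1)
    rw [this, zero_add]

theorem trans {a b c : ℝ} {w : ℝ → ℝ} (h : IsPower a b w) (h' : IsPower b c w) :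
    IsPower a c w := by
  revert h
  exact induction (C := fun b c w => IsPower a b w → IsPower a c w) (fun _ _ _ h => h)
    (fun _ _ _ _ _ _ hbc hv hw ih h => (ih h).snoc hbc hv hw) h'

/-- Needed to cut the middle part out of a policy before new ends are attached to it. -/
theorem restrict {a b c d : ℝ} {w : ℝ → ℝ} (h : IsPower a b w) (hac : a ≤ c) (hcd : c ≤ d)
    (hdb : d ≤ b) : IsPower c d w := by
  suffices H : ∀ c d, a ≤ c → c ≤ d → d ≤ b → IsPower c d w from H c d hac hcd hdb
  clear hac hcd hdb c d
  refine induction (C := fun a b w => ∀ c d, a ≤ c → c ≤ d → d ≤ b → IsPower c d w)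
    (fun a w ha c d h1 h2 h3 => empty (ha.trans h1) (by linarith) _) ?_ h
  intro a b b' v w hP hbb hv hw ih c d hac hcd hdb
  have ha := hP.nonneg.1
  rcases le_total d b with hd | hd
  · exact ih c d hac hcd hd
  rcases le_total c b with hc | hc
  · exact (ih c b hac hc le_rfl).snoc hd hv fun t ht => hw t ⟨ht.1, ht.2.trans_le hdb⟩
  · exact (const (ha.trans hac) hcd hv).congr fun t ht =>
      (hw t ⟨hc.trans ht.1, ht.2.trans_le hdb⟩).symm

/-- Gluing at time `c`. -/
theorem ite_lt {a b c : ℝ} {v w : ℝ → ℝ} (h : IsPower a c v) (h' : IsPower c b w) :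
    IsPower a b fun t => if t < c then v t else w t :=
  (h.congr fun _ ht => (if_pos ht.2).symm).trans
    (h'.congr fun _ ht => (if_neg (not_lt.2 ht.1)).symm)

end IsPower

/-! ### Harvested energy as a function of the number of arrivals -/

namespace System

variable (S : System)

/-- The energy harvested by the first `k` arrivals. -/
noncomputable def harvestSum (k : ℕ) : ℝ := ∑ i ∈ Finset.range k, S.e i

theorem harvestedUpTo_eq (n : ℕ) : S.harvestedUpTo n = S.harvestSum (n + 1) := rfl

theorem harvestSum_zero : S.harvestSum 0 = 0 := Finset.sum_range_zero _

theorem harvestSum_strictMono : StrictMono S.harvestSum :=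
  strictMono_nat_of_lt_succ fun k => by
    rw [harvestSum, harvestSum, Finset.sum_range_succ]
    linarith [S.e_pos k]

theorem harvestSum_nonneg (k : ℕ) : 0 ≤ S.harvestSum k := by
  rw [← S.harvestSum_zero]
  exact S.harvestSum_strictMono.monotone k.zero_le

theorem harvestSum_pos {k : ℕ} (hk : 0 < k) : 0 < S.harvestSum k := by
  rw [← S.harvestSum_zero]
  exact S.harvestSum_strictMono hk

theorem τ_nonneg (k : ℕ) : 0 ≤ S.τ k := by
  rw [← S.τ_zero]
  exact S.τ_strictMono.monotone k.zero_le

theorem exists_le_τ (t : ℝ) : ∃ i, t ≤ S.τ i := (S.τ_tendsto.eventually_ge_atTop t).exists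

open Classical in
/-- The number of arrivals before time `t`. -/
noncomputable def arrivals (t : ℝ) : ℕ := Nat.find (S.exists_le_τ t)

theorem lt_arrivals_iff {i : ℕ} {t : ℝ} : i < S.arrivals t ↔ S.τ i < t := by
  classical
  rw [arrivals, Nat.lt_find_iff]
  refine ⟨fun h => not_le.1 (h i le_rfl), fun h m hm => not_le.2 ?_⟩
  exact (S.τ_strictMono.monotone hm).trans_lt h

theorem arrivals_le_iff {i : ℕ} {t : ℝ} : S.arrivals t ≤ i ↔ t ≤ S.τ i := by
  rw [← not_lt, lt_arrivals_iff, not_lt]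

theorem le_τ_arrivals (t : ℝ) : t ≤ S.τ (S.arrivals t) := S.arrivals_le_iff.1 le_rfl

theorem arrivals_mono : Monotone S.arrivals := fun _ _ hst =>
  S.arrivals_le_iff.2 (hst.trans (S.le_τ_arrivals _))

theorem arrivals_τ (k : ℕ) : S.arrivals (S.τ k) = k :=
  le_antisymm (S.arrivals_le_iff.2 le_rfl)
    (S.τ_strictMono.le_iff_le.1 (S.le_τ_arrivals _))

theorem harvestedBefore_eq (t : ℝ) : S.harvestedBefore t = S.harvestSum (S.arrivals t) := by
  rw [harvestedBefore, harvestSum, tsum_eq_sum (s := Finset.range (S.arrivals t))]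
  · exact Finset.sum_congr rfl fun i hi => if_pos (S.lt_arrivals_iff.1 (Finset.mem_range.1 hi))
  · exact fun i hi => if_neg fun h => hi (Finset.mem_range.2 (S.lt_arrivals_iff.2 h))

theorem harvestedBefore_τ (k : ℕ) : S.harvestedBefore (S.τ k) = S.harvestSum k := by
  rw [harvestedBefore_eq, arrivals_τ]

theorem harvestedBefore_mono : Monotone S.harvestedBefore := fun s t hst => by
  rw [harvestedBefore_eq, harvestedBefore_eq]
  exact S.harvestSum_strictMono.monotone (S.arrivals_mono hst)

theorem harvestedBefore_nonneg (t : ℝ) : 0 ≤ S.harvestedBefore t := by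
  rw [harvestedBefore_eq]
  exact S.harvestSum_nonneg _

theorem leftEnergy_eq (l : ℕ) : S.leftEnergy l = S.harvestSum l := S.harvestedBefore_τ l

theorem rightEnergy_eq (P : Policy) (r : ℕ) :
    S.rightEnergy P r = S.harvestSum (S.arrivals P.finish) - S.harvestSum r := by
  rw [rightEnergy, harvestedBefore_τ, harvestedBefore_eq]

/-- A transmission with constant power that in the end has used the energy of the first `K`
arrivals is feasible as soon as it is feasible just before each of these arrivals. -/
theorem lineFeasible_iff {a b u p : ℝ} {K : ℕ} (hp : 0 < p) (hab : a ≤ b)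
    (hK : u + p * (b - a) = S.harvestSum K) :
    S.LineFeasible a b u p ↔ ∀ i < K, a ≤ S.τ i → u + p * (S.τ i - a) ≤ S.harvestSum i := by
  constructor
  · intro h i hi hai
    rcases le_or_gt (S.τ i) b with hib | hib
    · simpa [harvestedBefore_τ] using h (S.τ i) ⟨hai, hib⟩
    · have h1 := h b ⟨hab, le_rfl⟩
      rw [hK, harvestedBefore_eq] at h1
      have h2 := S.harvestSum_strictMono.le_iff_le.1 h1
      have h3 := S.arrivals_le_iff.2 hib.le
      omega
  · intro h t ht
    rw [harvestedBefore_eq]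
    -- The harvested energy is constant from `t` to the next arrival `τ (arrivals t)`, while the
    -- line increases; so the check at that arrival covers `t`. Once `K` arrivals have occurred,
    -- their energy pays for the whole line.
    rcases lt_or_ge (S.arrivals t) K with hc | hc
    · have h1 := S.le_τ_arrivals t
      have h2 := h _ hc (ht.1.trans h1)
      have h3 := mul_le_mul_of_nonneg_left (sub_le_sub_right h1 a) hp.le
      linarith
    · have h1 := S.harvestSum_strictMono.monotone hc
      have h3 := mul_le_mul_of_nonneg_left (sub_le_sub_right ht.2 a) hp.le
      linarith

/-- The final instant of such a transmission comes after the last of these arrivals. -/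
theorem τ_lt_of_lineFeasible {a b u p : ℝ} {K i : ℕ} (hab : a ≤ b)
    (hK : u + p * (b - a) = S.harvestSum K) (h : S.LineFeasible a b u p) (hi : i < K) :
    S.τ i < b := by
  have h1 := h b ⟨hab, le_rfl⟩
  rw [hK, harvestedBefore_eq] at h1
  exact S.lt_arrivals_iff.1 (hi.trans_le (S.harvestSum_strictMono.le_iff_le.1 h1))

theorem g_zero : S.g 0 = 0 := S.rate.map_zero

end System

/-! ### Supporting lines of the rate function -/

namespace IsRateFunction

variable {g : ℝ → ℝ} (hg : IsRateFunction g)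
include hg

theorem pos {p : ℝ} (hp : 0 < p) : 0 < g p := by
  have := hg.strictMono (mem_Ici.2 le_rfl) (mem_Ici.2 hp.le) hp
  rwa [hg.map_zero] at this

theorem continuousOn : ContinuousOn g (Ioi 0) := by
  have := hg.strictConcave.concaveOn.continuousOn_interior
  rwa [interior_Ici] at this

theorem ratio_continuousOn : ContinuousOn (fun x => g x / x) (Ioi 0) :=
  hg.continuousOn.div continuousOn_id fun _ hx => (mem_Ioi.1 hx).ne'

theorem ratio_lt {p q : ℝ} (hp : 0 < p) (hpq : p < q) : g q / q < g p / p :=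
  hg.ratio_strictAnti (mem_Ioi.2 hp) (mem_Ioi.2 (hp.trans hpq)) hpq

theorem ratio_le {p q : ℝ} (hp : 0 < p) (hpq : p ≤ q) : g q / q ≤ g p / p :=
  hg.ratio_strictAnti.antitoneOn (mem_Ioi.2 hp) (mem_Ioi.2 (hp.trans_le hpq)) hpq

theorem le_of_ratio_le {p q : ℝ} (hq : 0 < q) (h : g q / q ≤ g p / p) : p ≤ q := by
  by_contra! hc
  exact absurd (hg.ratio_lt hq hc) (not_lt.2 h)

/-- The number of bits per unit of energy falls continuously to 0, so every smaller positive value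
is attained at a higher power. -/
theorem exists_ratio_eq {p v : ℝ} (hp : 0 < p) (hv : 0 < v) (hvp : v ≤ g p / p) :
    ∃ q, p ≤ q ∧ g q / q = v := by
  obtain ⟨q, hq, hpq⟩ := ((hg.ratio_tendsto.eventually_lt_const hv).and
    (eventually_ge_atTop p)).exists
  obtain ⟨x, hx, hxv⟩ := intermediate_value_Icc' hpq
    (hg.ratio_continuousOn.mono fun x hx => mem_Ioi.2 (hp.trans_le hx.1)) ⟨hq.le, hvp⟩
  exact ⟨x, hx.1, hxv⟩

theorem slope_lt {p q q' : ℝ} (hq : 0 ≤ q) (h1 : q < p) (h2 : p < q') :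
    (g q' - g p) / (q' - p) < (g p - g q) / (p - q) :=
  hg.strictConcave.slope_anti_adjacent (mem_Ici.2 hq) (mem_Ici.2 (by linarith)) h1 h2

/-- The slope is the supremum of the slopes of the chords to the right of `p`; by concavity all
chords to the left are steeper. Strict concavity makes the line strict off `p`. -/
theorem exists_supporting {p : ℝ} (hp : 0 < p) :
    ∃ c, ∀ q, 0 ≤ q → q ≠ p → g q < g p + c * (q - p) := by
  set A := (fun q => (g q - g p) / (q - p)) '' Ioi p with hA
  have hbdd : ∀ q, 0 ≤ q → q < p → (g p - g q) / (p - q) ∈ upperBounds A := by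
    rintro q hq hqp _ ⟨q', hq', rfl⟩
    exact (hg.slope_lt hq hqp hq').le
  have hne : A.Nonempty := ⟨_, p + 1, by simp, rfl⟩
  have key1 : ∀ q, p < q → (g q - g p) / (q - p) < sSup A := by
    intro q hq
    -- The chord to the midpoint is strictly steeper than the chord to `q`, which makes the
    -- comparison with the supremum strict. The same device works on the left.
    have h1 : (g ((p + q) / 2) - g p) / ((p + q) / 2 - p) ≤ sSup A :=
      le_csSup ⟨_, hbdd 0 le_rfl hp⟩ ⟨(p + q) / 2, by simp; linarith, rfl⟩
    refine lt_of_lt_of_le ?_ h1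
    have h2 := hg.slope_lt hp.le (show p < (p + q) / 2 by linarith)
      (show (p + q) / 2 < q by linarith)
    rw [div_lt_div_iff₀ (by linarith) (by linarith)] at h2 ⊢
    nlinarith
  have key2 : ∀ q, 0 ≤ q → q < p → sSup A < (g p - g q) / (p - q) := by
    intro q hq hqp
    have h1 : sSup A ≤ (g p - g ((p + q) / 2)) / (p - (p + q) / 2) :=
      csSup_le hne (hbdd _ (by linarith) (by linarith))
    refine h1.trans_lt ?_
    have h2 := hg.slope_lt hq (show q < (p + q) / 2 by linarith) (show (p + q) / 2 < p by linarith)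
    rw [div_lt_div_iff₀ (by linarith) (by linarith)] at h2 ⊢
    nlinarith
  refine ⟨sSup A, fun q hq hqp => ?_⟩
  rcases lt_or_gt_of_ne hqp with h | h
  · have := key2 q hq h
    rw [lt_div_iff₀ (by linarith)] at this
    linarith
  · have := key1 q h
    rw [div_lt_iff₀ (by linarith)] at this
    linarith

end IsRateFunction

open Classical in
/-- The slope of a line above the graph of `g` that touches it at `p`. -/
noncomputable def supportSlope (g : ℝ → ℝ) (p : ℝ) : ℝ :=
  if h : ∃ c, ∀ q, 0 ≤ q → q ≠ p → g q < g p + c * (q - p) then h.choose else 0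

/-- The value at zero of this line. -/
noncomputable def supportIntercept (g : ℝ → ℝ) (p : ℝ) : ℝ := g p - supportSlope g p * p

namespace IsRateFunction

variable {g : ℝ → ℝ} (hg : IsRateFunction g)
include hg

theorem lt_support {p q : ℝ} (hp : 0 < p) (hq : 0 ≤ q) (hqp : q ≠ p) :
    g q < supportIntercept g p + supportSlope g p * q := by
  have h := hg.exists_supporting hp
  have := h.choose_spec q hq hqp
  rw [supportIntercept, supportSlope, dif_pos h]
  linarith

theorem le_support {p q : ℝ} (hp : 0 < p) (hq : 0 ≤ q) :
    g q ≤ supportIntercept g p + supportSlope g p * q := by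
  rcases eq_or_ne q p with rfl | h
  · simp [supportIntercept]
  · exact (hg.lt_support hp hq h).le

theorem supportSlope_nonneg {p : ℝ} (hp : 0 < p) : 0 ≤ supportSlope g p := by
  have h := hg.le_support hp (show 0 ≤ p + 1 by linarith)
  have h' := hg.strictMono (mem_Ici.2 hp.le) (mem_Ici.2 (show 0 ≤ p + 1 by linarith)) (by linarith)
  rw [supportIntercept] at h
  linarith

/-- Each supporting line is evaluated at the contact point of the other and the two inequalities are
added. The slope acts as the price of energy, which falls as the power rises, while the intercept,
the price of on-time, grows. -/
theorem supportSlope_anti {p q : ℝ} (hp : 0 < p) (hpq : p ≤ q) :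
    supportSlope g q ≤ supportSlope g p := by
  rcases hpq.eq_or_lt with rfl | hpq
  · exact le_rfl
  have h1 := hg.le_support hp (hp.trans hpq).le
  have h2 := hg.le_support (hp.trans hpq) hp.le
  rw [supportIntercept] at h1 h2
  by_contra! hc
  nlinarith

theorem supportIntercept_nonneg {p : ℝ} (hp : 0 < p) : 0 ≤ supportIntercept g p := by
  have := hg.le_support hp le_rfl
  rw [hg.map_zero] at this
  linarith

theorem supportIntercept_mono {p q : ℝ} (hp : 0 < p) (hpq : p ≤ q) :
    supportIntercept g p ≤ supportIntercept g q := by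
  have h1 := hg.le_support (hp.trans_le hpq) hp.le
  have h2 := mul_le_mul_of_nonneg_right (hg.supportSlope_anti hp hpq) hp.le
  rw [supportIntercept]
  linarith

end IsRateFunction

/-! ### Bits sent with a fixed amount of energy -/

namespace System

variable (S : System)

theorem burst_eq {E d : ℝ} (hE : 0 < E) (hd : 0 < d) :
    S.burst E d = E * (S.g (E / d) / (E / d)) := by
  rw [burst]; field_simp

/-- A longer transmission with the same energy has lower power, hence more bits per unit of energy.
-/
theorem burst_lt {E d d' : ℝ} (hE : 0 < E) (hd : 0 < d) (hdd : d < d') :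
    S.burst E d < S.burst E d' := by
  rw [S.burst_eq hE hd, S.burst_eq hE (hd.trans hdd)]
  refine mul_lt_mul_of_pos_left (S.rate.ratio_lt (div_pos hE (hd.trans hdd)) ?_) hE
  exact div_lt_div_of_pos_left hE hd hdd

theorem burst_le {E d d' : ℝ} (hE : 0 < E) (hd : 0 < d) (hdd : d ≤ d') :
    S.burst E d ≤ S.burst E d' := by
  rcases hdd.eq_or_lt with rfl | h
  exacts [le_rfl, (S.burst_lt hE hd h).le]

theorem le_of_burst_le {E d d' : ℝ} (hE : 0 < E) (hd' : 0 < d')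
    (h : S.burst E d ≤ S.burst E d') : d ≤ d' := by
  by_contra! hc
  exact absurd (S.burst_lt hE hd' hc) (not_lt.2 h)

theorem burst_mul {p d : ℝ} (hd : 0 < d) : S.burst (p * d) d = d * S.g p := by
  rw [burst, mul_div_cancel_right₀ _ hd.ne']

theorem exists_burst_eq {E B D : ℝ} (hE : 0 < E) (hB : 0 < B) (hD : 0 < D)
    (h : B ≤ S.burst E D) : ∃ d, 0 < d ∧ d ≤ D ∧ S.burst E d = B := by
  rw [S.burst_eq hE hD] at h
  obtain ⟨q, hq, hqB⟩ := S.rate.exists_ratio_eq (p := E / D) (v := B / E) (div_pos hE hD)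
    (div_pos hB hE) (by rw [div_le_iff₀ hE]; linarith)
  have hq0 : 0 < q := lt_of_lt_of_le (by positivity) hq
  refine ⟨E / q, by positivity, ?_, ?_⟩
  · rw [div_le_iff₀ hq0]
    rw [div_le_iff₀ hD] at hq
    linarith
  · have : E / (E / q) = q := by field_simp
    rw [S.burst_eq hE (by positivity), this, hqB]
    field_simp

theorem burst_continuousOn {E : ℝ} (hE : 0 < E) : ContinuousOn (S.burst E) (Ioi 0) := by
  refine continuousOn_id.mul (S.rate.continuousOn.comp
    (continuousOn_const.div continuousOn_id fun _ hx => (mem_Ioi.1 hx).ne') ?_)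
  exact fun x hx => mem_Ioi.2 (div_pos hE (mem_Ioi.1 hx))

/-- The bits that are sent with little energy per bit vanish as the time does. -/
theorem burst_tendsto_zero {E : ℝ} (hE : 0 < E) : Tendsto (S.burst E) (𝓝[>] 0) (𝓝 0) := by
  have h1 : Tendsto (fun d : ℝ => E / d) (𝓝[>] 0) atTop := by
    simpa [div_eq_mul_inv] using tendsto_inv_nhdsGT_zero.const_mul_atTop hE
  have h2 := (S.rate.ratio_tendsto.comp h1).const_mul E
  rw [mul_zero] at h2
  refine h2.congr' ?_
  filter_upwards [self_mem_nhdsWithin] with d hd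
  exact (S.burst_eq hE hd).symm

theorem burst_zero_right (E : ℝ) : S.burst E 0 = 0 := by simp [burst]

/-- Continuity down to duration 0 is what QUIT needs when the iteration has removed the whole part
after `τ r`. At 0 it rests on `g x / x` tending to 0 at infinity. -/
theorem burst_continuousOn_Ici {E : ℝ} (hE : 0 < E) : ContinuousOn (S.burst E) (Ici 0) := by
  intro x hx
  rcases (mem_Ici.1 hx).eq_or_lt with rfl | h
  · rw [← continuousWithinAt_Ioi_iff_Ici, ContinuousWithinAt, burst_zero_right]
    exact S.burst_tendsto_zero hE
  · exact ((S.burst_continuousOn hE).continuousAt (Ioi_mem_nhds h)).continuousWithinAt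


/-! ### Taut policies and the optimality criterion -/

variable (S : System)

/-- The policy sends all bits, obeys the energy constraint, uses all energy harvested before its
end, and its power is positive, nondecreasing, and increases only at instants at which no energy
is left. -/
structure IsTaut (P : Policy) : Prop where
  start_lt : P.start < P.finish
  pos : ∀ t ∈ Ico P.start P.finish, 0 < P.power t
  mono : MonotoneOn P.power (Ico P.start P.finish)
  jump : ∀ s ∈ Ico P.start P.finish, ∀ t ∈ Ico P.start P.finish, s < t → P.power s ≠ P.power t →
    ∃ i, s < S.τ i ∧ S.τ i ≤ t ∧ P.energyUsed (S.τ i) = S.harvestSum i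
  energy : ∀ t ∈ Icc P.start P.finish, P.energyUsed t ≤ S.harvestedBefore t
  energy_finish : P.energyUsed P.finish = S.harvestedBefore P.finish
  bits_finish : P.bits S.g P.finish = S.B₀

variable {S}

theorem IsFeasible.energyUsed_le {Q : Policy} (hQ : S.IsFeasible Q) {t : ℝ} (ht : 0 ≤ t) :
    Q.energyUsed t ≤ S.harvestedBefore t := by
  rcases le_total t Q.finish with h | h
  · exact hQ.energy t ⟨ht, h⟩
  · rw [Q.energyUsed_eq_total, Q.total_of_finish_le _ h, ← Q.energyUsed_eq_total]
    exact (hQ.energy _ ⟨Q.start_nonneg.trans Q.start_le_finish, le_rfl⟩).trans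
      (S.harvestedBefore_mono h)

theorem IsFeasible.onTime_le {Q : Policy} (hQ : S.IsFeasible Q) {t : ℝ} (ht : 0 ≤ t) :
    Q.onTime t ≤ S.Γ₀ := by
  rcases le_total t Q.finish with h | h
  · exact hQ.receiver t ⟨ht, h⟩
  · rw [Q.onTime_eq_total, Q.total_of_finish_le _ h, ← Q.onTime_eq_total]
    exact hQ.receiver _ ⟨Q.start_nonneg.trans Q.start_le_finish, le_rfl⟩

theorem onTime_le_self (Q : Policy) {t : ℝ} (ht : 0 ≤ t) : Q.onTime t ≤ t := by
  have h := Q.onTime_sub_le ht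
  have h0 : Q.onTime 0 = 0 := by
    rw [Q.onTime_eq_total]
    exact Q.total_of_le_start _ Q.start_nonneg
  linarith

namespace IsTaut

variable {P : Policy} (hP : S.IsTaut P)
include hP

theorem isFeasible (hdur : P.duration ≤ S.Γ₀) : S.IsFeasible P where
  bits_eq := hP.bits_finish
  energy t ht := by
    rcases le_total t P.start with h | h
    · rw [P.energyUsed_of_le_start h]
      exact S.harvestedBefore_nonneg t
    · exact hP.energy t ⟨h, ht.2⟩
  receiver t _ := (P.onTime_le_duration t).trans hdur

/-- Between two consecutive instants at which the power may change, it is constant. -/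
theorem power_eq_of_no_touch {s t : ℝ} (hs : s ∈ Ico P.start P.finish)
    (ht : t ∈ Ico P.start P.finish) (hst : s ≤ t)
    (h : ∀ i, s < S.τ i → S.τ i ≤ t → P.energyUsed (S.τ i) ≠ S.harvestSum i) :
    P.power t = P.power s := by
  by_contra hne
  rcases hst.eq_or_lt with rfl | hst
  · exact hne rfl
  obtain ⟨i, h1, h2, h3⟩ := hP.jump s hs t ht hst (Ne.symm hne)
  exact h i h1 h2 h3

/-- The comparison of `P` with a feasible policy `Q` at time `t`. -/
theorem bits_le_step {Q : Policy} (hQ : S.IsFeasible Q) {s t : ℝ}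
    (hs : s ∈ Ico P.start P.finish) (ht : t ∈ Ico P.start P.finish) (hst : s ≤ t)
    (harr : ∀ i, s < S.τ i → t ≤ S.τ i)
    (h : Q.bits S.g s ≤ P.bits S.g s
      + supportSlope S.g (P.power s) * (Q.energyUsed s - P.energyUsed s)
      + supportIntercept S.g (P.power P.start) * (Q.onTime s - (s - P.start))) :
    Q.bits S.g t ≤ P.bits S.g t
      + supportSlope S.g (P.power t) * (Q.energyUsed t - P.energyUsed t)
      + supportIntercept S.g (P.power P.start) * (Q.onTime t - (t - P.start)) := by
  have ha : P.start ∈ Ico P.start P.finish := ⟨le_rfl, hP.start_lt⟩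
  have hp := hP.pos s hs
  have hconst : ∀ x ∈ Ico s t, P.power x = P.power s := fun x hx =>
    hP.power_eq_of_no_touch hs ⟨hs.1.trans hx.1, hx.2.trans ht.2⟩ hx.1 fun i h1 h2 =>
      absurd (harr i h1) (not_le.2 (h2.trans_lt hx.2))
  have hU := P.energyUsed_sub_of_const hst hconst
  have hB := P.bits_sub_of_const S.g_zero hst hconst
  have hQB := Q.bits_sub_le S.g_zero (fun q hq => S.rate.le_support hp hq) hst
  have hO := Q.onTime_sub_le hst
  -- The competitor's on-time grows by at most `t - s`, so the on-time difference only decreases;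
  -- charging it at the starting price, the lowest one, weakens the bound.
  have hμ := S.rate.supportIntercept_mono (hP.pos _ ha) (hP.mono ha hs hs.1)
  have hμO := mul_nonneg (sub_nonneg.2 hμ) (sub_nonneg.2 hO)
  have hline : S.g (P.power s)
      = supportIntercept S.g (P.power s) + supportSlope S.g (P.power s) * P.power s := by
    rw [supportIntercept]; ring
  have key : Q.bits S.g t ≤ P.bits S.g t
      + supportSlope S.g (P.power s) * (Q.energyUsed t - P.energyUsed t)
      + supportIntercept S.g (P.power P.start) * (Q.onTime t - (t - P.start)) := by
    have e1 : P.bits S.g t = P.bits S.g s + S.g (P.power s) * (t - s) := by linarith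
    have e2 : P.energyUsed t = P.energyUsed s + P.power s * (t - s) := by linarith
    rw [e1, e2, hline]
    linarith
  by_cases hne : P.power s = P.power t
  · rwa [← hne]
  have hst' : s < t := lt_of_le_of_ne hst fun h => hne (h ▸ rfl)
  -- The price of energy changes only here, where `P` has an empty battery. The competitor has used
  -- no more energy than `P`, so the lower price makes a nonpositive term larger.
  obtain ⟨i, h1, h2, h3⟩ := hP.jump s hs t ht hst' hne
  have hti : t = S.τ i := le_antisymm (harr i h1) h2
  have hle : Q.energyUsed t - P.energyUsed t ≤ 0 := by
    rw [hti, h3, ← S.harvestedBefore_τ, sub_nonpos]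
    exact hQ.energyUsed_le (S.τ_nonneg i)
  have hν := S.rate.supportSlope_anti hp (hP.mono hs ht hst)
  have := mul_nonneg_of_nonpos_of_nonpos (sub_nonpos.2 hν) hle
  linarith

/-- Weak duality on an initial segment, by induction over the arrivals. The maximum with `P.start`
collapses all arrivals before the start to the start itself, where the supporting line at the first
power bounds what `Q` has sent. -/
theorem bits_le {Q : Policy} (hQ : S.IsFeasible Q) (i : ℕ) (hi : max P.start (S.τ i) < P.finish) :
    Q.bits S.g (max P.start (S.τ i)) ≤ P.bits S.g (max P.start (S.τ i))
      + supportSlope S.g (P.power (max P.start (S.τ i)))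
        * (Q.energyUsed (max P.start (S.τ i)) - P.energyUsed (max P.start (S.τ i)))
      + supportIntercept S.g (P.power P.start)
        * (Q.onTime (max P.start (S.τ i)) - (max P.start (S.τ i) - P.start)) := by
  induction i with
  | zero =>
    have ha : P.start ∈ Ico P.start P.finish := ⟨le_rfl, hP.start_lt⟩
    rw [S.τ_zero, max_eq_left P.start_nonneg, P.bits_of_le_start _ le_rfl,
      P.energyUsed_of_le_start le_rfl]
    have h := Q.bits_sub_le S.g_zero (fun q hq => S.rate.le_support (hP.pos _ ha) hq)
      P.start_nonneg
    rw [Q.bits_of_le_start _ Q.start_nonneg, Q.energyUsed_of_le_start Q.start_nonneg,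
      Q.onTime_eq_total, Q.total_of_le_start _ Q.start_nonneg, ← Q.onTime_eq_total] at h
    linarith
  | succ i ih =>
    have hlt := S.τ_strictMono (Nat.lt_succ_self i)
    have hle : max P.start (S.τ i) ≤ max P.start (S.τ (i + 1)) := max_le_max_left _ hlt.le
    refine hP.bits_le_step hQ ⟨le_max_left _ _, hle.trans_lt hi⟩ ⟨le_max_left _ _, hi⟩ hle ?_
      (ih (hle.trans_lt hi))
    intro j hj
    have h1 := (max_lt_iff.1 hj).2
    exact max_le (max_lt_iff.1 hj).1.le
      (S.τ_strictMono.monotone (S.τ_strictMono.lt_iff_lt.1 h1))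

/-- A policy that is locally optimal, has used all energy at some earlier instant and cannot be
on for a longer time is optimal. -/
theorem isOptimal (htouch : ∃ i, P.start ≤ S.τ i ∧ S.τ i < P.finish ∧
      P.energyUsed (S.τ i) = S.harvestSum i)
    (hdur : P.duration ≤ S.Γ₀) (hend : P.start = 0 ∨ P.duration = S.Γ₀) : S.IsOptimal P := by
  refine ⟨hP.isFeasible hdur, fun Q hQ => ?_⟩
  by_contra! hlt
  obtain ⟨c, ⟨hac, hcb, hUc⟩, hmax⟩ : ∃ c, (P.start ≤ S.τ c ∧ S.τ c < P.finish ∧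
      P.energyUsed (S.τ c) = S.harvestSum c) ∧ ∀ i, c < i → S.τ i < P.finish →
      P.energyUsed (S.τ i) ≠ S.harvestSum i := by
    classical
    obtain ⟨i₀, hi₀⟩ := htouch
    have hfin : {i | P.start ≤ S.τ i ∧ S.τ i < P.finish ∧
        P.energyUsed (S.τ i) = S.harvestSum i}.Finite :=
      (Set.finite_lt_nat (S.arrivals P.finish)).subset fun i hi => S.lt_arrivals_iff.2 hi.2.1
    obtain ⟨c, hc⟩ := hfin.exists_maximal ⟨i₀, hi₀⟩
    refine ⟨c, hc.1, fun i hci hi heq => ?_⟩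
    have := hc.2 (y := i) ⟨hc.1.1.trans (S.τ_strictMono hci).le, hi, heq⟩ hci.le
    omega
  have ha : P.start ∈ Ico P.start P.finish := ⟨le_rfl, hP.start_lt⟩
  have hc : S.τ c ∈ Ico P.start P.finish := ⟨hac, hcb⟩
  set p := P.power (S.τ c) with hp_def
  have hp : 0 < p := hP.pos _ hc
  have hconst : ∀ x ∈ Ico (S.τ c) P.finish, P.power x = p := fun x hx =>
    hP.power_eq_of_no_touch hc ⟨hac.trans hx.1, hx.2⟩ hx.1 fun i h1 h2 =>
      hmax i (S.τ_strictMono.lt_iff_lt.1 h1) (h2.trans_lt hx.2)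
  have hU := P.energyUsed_sub_of_const hcb.le hconst
  have hB := P.bits_sub_of_const S.g_zero hcb.le hconst
  rw [hP.energy_finish, hUc] at hU
  rw [hP.bits_finish] at hB
  -- A time by which `Q` has ended, still before the end of `P`, and strictly after `τ c` so that
  -- the power below makes sense.
  obtain ⟨T, hTQ, hTc, hTb⟩ : ∃ T, Q.finish ≤ T ∧ S.τ c < T ∧ T < P.finish := by
    have h1 : max Q.finish (S.τ c) < P.finish := max_lt hlt hcb
    have h2 := le_max_left Q.finish (S.τ c)
    have h3 := le_max_right Q.finish (S.τ c)
    exact ⟨(max Q.finish (S.τ c) + P.finish) / 2, by linarith, by linarith, by linarith⟩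
  have hT0 : 0 ≤ T := (S.τ_nonneg c).trans hTc.le
  -- The power that would spend by `T` all the energy that `P` uses after `τ c`. From `τ c` to `T`,
  -- the competitor is measured against the supporting line at this higher power.
  set p' := p * (P.finish - S.τ c) / (T - S.τ c) with hp'_def
  have hp'T : p' * (T - S.τ c) = p * (P.finish - S.τ c) :=
    div_mul_cancel₀ _ (by linarith)
  have hpp' : p < p' := by
    rw [hp'_def, lt_div_iff₀ (by linarith)]
    exact mul_lt_mul_of_pos_left (by linarith) hp
  have hp' : 0 < p' := hp.trans hpp'
  have hA := hP.bits_le hQ c (by rw [max_eq_right hac]; exact hcb)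
  rw [max_eq_right hac, hUc, ← hp_def] at hA
  have hUQc : Q.energyUsed (S.τ c) - S.harvestSum c ≤ 0 := by
    rw [← S.harvestedBefore_τ, sub_nonpos]
    exact hQ.energyUsed_le (S.τ_nonneg c)
  have hQB := Q.bits_sub_le S.g_zero (fun q hq => S.rate.le_support hp' hq) hTc.le
  have hQT : Q.bits S.g T = S.B₀ := by
    rw [Q.bits_eq_total, Q.total_of_finish_le _ hTQ, ← Q.bits_eq_total, hQ.bits_eq]
  have hUQT : Q.energyUsed T ≤ S.harvestedBefore P.finish :=
    (hQ.energyUsed_le hT0).trans (S.harvestedBefore_mono hTb.le)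
  -- This is where it matters that `P` cannot be on longer: the priced on-time term has the right
  -- sign.
  have hOT : Q.onTime T ≤ P.finish - P.start := by
    rcases hend with h | h
    · rw [h, sub_zero]
      exact (onTime_le_self Q hT0).trans hTb.le
    · exact (hQ.onTime_le hT0).trans h.ge
  have hO := Q.onTime_sub_le hTc.le
  have hμ1 := S.rate.supportIntercept_nonneg (hP.pos _ ha)
  have hμ2 := S.rate.supportIntercept_mono (hP.pos _ ha) (hP.mono ha hc hac)
  have hμ3 := S.rate.supportIntercept_mono hp hpp'.le
  have hν1 := S.rate.supportSlope_anti hp hpp'.le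
  have hν0 := S.rate.supportSlope_nonneg hp'
  -- The source of the contradiction: compressing the last piece from `P.finish` to `T` loses
  -- strictly more bits than the on-time saved is worth at the price for `p`.
  have hstrict := S.rate.lt_support hp hp'.le hpp'.ne'
  rw [← hp_def] at hμ2
  have e1 := mul_nonneg_of_nonpos_of_nonpos (sub_nonpos.2 hν1) hUQc
  have e2 := mul_nonneg hν0 (sub_nonneg.2 hUQT)
  have e3 := mul_nonneg (sub_nonneg.2 (hμ2.trans hμ3)) (sub_nonneg.2 hO)
  have e4 := mul_nonneg hμ1 (sub_nonneg.2 hOT)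
  have e5 := mul_nonneg (sub_nonneg.2 hμ2) (sub_nonneg.2 hTb.le)
  have e6 := mul_lt_mul_of_pos_right hstrict (sub_pos.2 hTc)
  have e7 : supportIntercept S.g p' = S.g p' - supportSlope S.g p' * p' := rfl
  have e8 : supportIntercept S.g p = S.g p - supportSlope S.g p * p := rfl
  have e9 : supportSlope S.g p' * p' * (T - S.τ c)
      = supportSlope S.g p' * (S.harvestedBefore P.finish - S.harvestSum c) := by
    rw [hU, mul_assoc, hp'T]
  have e10 : supportSlope S.g p * p' * (T - S.τ c)
      = supportSlope S.g p * p * (P.finish - S.τ c) := by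
    rw [mul_assoc, hp'T, mul_assoc]
  rw [hQT] at hQB
  have e11 : supportIntercept S.g p' * (T - S.τ c) = S.g p' * (T - S.τ c)
      - supportSlope S.g p' * (S.harvestedBefore P.finish - S.harvestSum c) := by
    rw [← e9, e7]; ring
  have e12 : supportIntercept S.g p * (P.finish - S.τ c) = S.g p * (P.finish - S.τ c)
      - supportSlope S.g p * p' * (T - S.τ c) := by
    rw [e10, e8]; ring
  clear_value p p'
  linarith only [e1, e2, e3, e4, e5, e6, e11, e12, hQB, hA, hB]

end IsTaut


/-! ### Taut pieces and their gluing -/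

variable (S : System)

/-- Between `c` and `d` the policy obeys the energy constraint, and its power is at least `ρ`,
nondecreasing, and increases only at instants at which no energy is left. -/
structure IsTautOn (P : Policy) (c d ρ : ℝ) : Prop where
  lb : ∀ t ∈ Ico c d, ρ ≤ P.power t
  mono : MonotoneOn P.power (Ico c d)
  jump : ∀ s ∈ Ico c d, ∀ t ∈ Ico c d, s < t → P.power s ≠ P.power t →
    ∃ i, s < S.τ i ∧ S.τ i ≤ t ∧ P.energyUsed (S.τ i) = S.harvestSum i
  energy : ∀ t ∈ Icc c d, P.energyUsed t ≤ S.harvestedBefore t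

variable {S} {P Q : Policy}

theorem IsTaut.isTautOn (hP : S.IsTaut P) {c d : ℝ} (hc : P.start ≤ c) (hd : d ≤ P.finish) :
    S.IsTautOn P c d (P.power c) where
  lb _ ht := hP.mono ⟨hc, (ht.1.trans_lt ht.2).trans_le hd⟩ ⟨hc.trans ht.1, ht.2.trans_le hd⟩ ht.1
  mono := hP.mono.mono (Ico_subset_Ico hc hd)
  jump s hs _ ht := hP.jump s (Ico_subset_Ico hc hd hs) _ (Ico_subset_Ico hc hd ht)
  energy t ht := hP.energy t (Icc_subset_Icc hc hd ht)

theorem isTautOn_const {c d p u : ℝ} (hp : ∀ t ∈ Ico c d, P.power t = p)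
    (hu : P.energyUsed c = u) (h : S.LineFeasible c d u p) : S.IsTautOn P c d p where
  lb t ht := (hp t ht).ge
  mono s hs t ht _ := ((hp s hs).trans (hp t ht).symm).le
  jump s hs t ht _ hne := absurd ((hp s hs).trans (hp t ht).symm) hne
  energy t ht := by
    have h1 := P.energyUsed_sub_of_const ht.1 fun x hx => hp x ⟨hx.1, hx.2.trans_le ht.2⟩
    have h2 := h t ht
    linarith

namespace IsTautOn

theorem energyUsed_congr {c d : ℝ} (hQ : ∀ t ∈ Ico c d, Q.power t = P.power t)
    (hU : Q.energyUsed c = P.energyUsed c) {t : ℝ} (ht : t ∈ Icc c d) :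
    Q.energyUsed t = P.energyUsed t := by
  have := P.total_sub_congr (f := id) (Q := Q) rfl ht.1
    fun x hx => hQ x ⟨hx.1, hx.2.trans_le ht.2⟩
  rw [← P.energyUsed_eq_total, ← Q.energyUsed_eq_total] at this
  linarith

theorem congr {c d ρ : ℝ} (h : S.IsTautOn P c d ρ)
    (hQ : ∀ t ∈ Ico c d, Q.power t = P.power t) (hU : Q.energyUsed c = P.energyUsed c) :
    S.IsTautOn Q c d ρ where
  lb t ht := by rw [hQ t ht]; exact h.lb t ht
  mono s hs t ht hst := by rw [hQ s hs, hQ t ht]; exact h.mono hs ht hst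
  jump s hs t ht hst hne := by
    rw [hQ s hs, hQ t ht] at hne
    obtain ⟨i, h1, h2, h3⟩ := h.jump s hs t ht hst hne
    refine ⟨i, h1, h2, ?_⟩
    rw [energyUsed_congr hQ hU ⟨(hs.1.trans_lt h1).le, h2.trans ht.2.le⟩, h3]
  energy t ht := by
    rw [energyUsed_congr hQ hU ht]
    exact h.energy t ht

theorem of_le {c d ρ ρ' : ℝ} (h : S.IsTautOn P c d ρ) (hρ : ρ' ≤ ρ) : S.IsTautOn P c d ρ' :=
  { h with lb := fun t ht => hρ.trans (h.lb t ht) }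

/-- The only new place where the power can rise is `τ j`, and there the battery is empty. The powers
on the left are at most the lower bound `ρ'` on the right, so monotonicity survives. -/
theorem glue {j : ℕ} {c d ρ ρ' : ℝ} (h : S.IsTautOn P c (S.τ j) ρ)
    (h' : S.IsTautOn P (S.τ j) d ρ') (hρ : ρ ≤ ρ')
    (hub : ∀ t ∈ Ico c (S.τ j), P.power t ≤ ρ')
    (hU : P.energyUsed (S.τ j) = S.harvestSum j) : S.IsTautOn P c d ρ where
  lb t ht := by
    rcases lt_or_ge t (S.τ j) with h1 | h1
    exacts [h.lb t ⟨ht.1, h1⟩, hρ.trans (h'.lb t ⟨h1, ht.2⟩)]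
  mono s hs t ht hst := by
    rcases lt_or_ge s (S.τ j) with h1 | h1
    · rcases lt_or_ge t (S.τ j) with h2 | h2
      · exact h.mono ⟨hs.1, h1⟩ ⟨ht.1, h2⟩ hst
      · exact (hub s ⟨hs.1, h1⟩).trans (h'.lb t ⟨h2, ht.2⟩)
    · exact h'.mono ⟨h1, hs.2⟩ ⟨h1.trans hst, ht.2⟩ hst
  jump s hs t ht hst hne := by
    rcases lt_or_ge s (S.τ j) with h1 | h1
    · rcases lt_or_ge t (S.τ j) with h2 | h2
      · exact h.jump s ⟨hs.1, h1⟩ t ⟨ht.1, h2⟩ hst hne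
      · exact ⟨j, h1, h2, hU⟩
    · exact h'.jump s ⟨h1, hs.2⟩ t ⟨h1.trans hst.le, ht.2⟩ hst hne
  energy t ht := by
    rcases le_total t (S.τ j) with h1 | h1
    exacts [h.energy t ⟨ht.1, h1⟩, h'.energy t ⟨h1, ht.2⟩]

theorem isTaut {ρ : ℝ} (h : S.IsTautOn P P.start P.finish ρ) (hρ : 0 < ρ)
    (hlt : P.start < P.finish) (hU : P.energyUsed P.finish = S.harvestedBefore P.finish)
    (hB : P.bits S.g P.finish = S.B₀) : S.IsTaut P where
  start_lt := hlt
  pos t ht := hρ.trans_le (h.lb t ht)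
  mono := h.mono
  jump := h.jump
  energy := h.energy
  energy_finish := hU
  bits_finish := hB

end IsTautOn

/-! ### The algorithm without receiver constraint -/

variable (S)

/-- For each later instant, either the energy harvested between the instants allows the power `ρ`
all the time, or it suffices for sending `B` bits with power `ρ`. -/
def KeepsRate (k : ℕ) (B ρ : ℝ) : Prop :=
  ∀ i, k < i → ρ * (S.τ i - S.τ k) ≤ S.harvestSum i - S.harvestSum k ∨
    ρ * B ≤ S.g ρ * (S.harvestSum i - S.harvestSum k)

variable {S}

section MinTime

variable {k m : ℕ} {B ρ E d : ℝ}

theorem sub_harvestSum_pos {i j : ℕ} (h : i < j) : 0 < S.harvestSum j - S.harvestSum i :=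
  sub_pos.2 (S.harvestSum_strictMono h)

theorem sub_τ_pos {i j : ℕ} (h : i < j) : 0 < S.τ j - S.τ i := sub_pos.2 (S.τ_strictMono h)

/-- The first power after the instant `τ k` is at least `ρ`. -/
theorem KeepsRate.le_rate (h : S.KeepsRate k B ρ) (hρ : 0 < ρ) {j : ℕ} (hkj : k < j) (hd : 0 < d)
    (hB : S.burst (S.harvestSum j - S.harvestSum k) d ≤ B) (hdj : d ≤ S.τ j - S.τ k) :
    ρ ≤ (S.harvestSum j - S.harvestSum k) / d := by
  have hE := sub_harvestSum_pos (S := S) hkj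
  rcases h j hkj with h1 | h1
  · rw [le_div_iff₀ hd]
    exact (mul_le_mul_of_nonneg_left hdj hρ.le).trans h1
  -- The energy `E` between the instants would send `B` bits at power `ρ`. At power `E / d` it sends
  -- at most `B`, so the bits per unit of energy are no more than at `ρ`, and the power is no less.
  · refine S.rate.le_of_ratio_le (div_pos hE hd) ?_
    rw [S.burst_eq hE hd] at hB
    rw [le_div_iff₀ hρ]
    refine le_of_mul_le_mul_left ?_ hE
    calc _ = ρ * ((S.harvestSum j - S.harvestSum k) * (S.g ((S.harvestSum j - S.harvestSum k) / d)
          / ((S.harvestSum j - S.harvestSum k) / d))) := by ring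
      _ ≤ ρ * B := mul_le_mul_of_nonneg_left hB hρ.le
      _ ≤ _ := by linarith

/-- For arrivals before `τ m`, minimality of the rate `r` up to `τ j` keeps later energies above the
line of slope `r` from `τ j`. For the others, `r < E / d` means that `r` sends more bits per unit of
energy, so `E` suffices for all `B` bits at power `r`; the share up to `τ j` is subtracted on both
sides. -/
theorem keepsRate_step {j : ℕ} {r : ℝ} (hE : E = S.harvestSum m - S.harvestSum k) (hd : 0 < d)
    (hB : S.burst E d = B) (hkj : k < j) (hjm : j < m)
    (hr : r = (S.harvestSum j - S.harvestSum k) / (S.τ j - S.τ k))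
    (hmin : ∀ i, k < i → i < m → r ≤ (S.harvestSum i - S.harvestSum k) / (S.τ i - S.τ k))
    (hlt : r < E / d) : S.KeepsRate j (B - S.g r * (S.τ j - S.τ k)) r := by
  have hrj : r * (S.τ j - S.τ k) = S.harvestSum j - S.harvestSum k := by
    rw [hr, div_mul_cancel₀ _ (sub_τ_pos hkj).ne']
  have hr0 : 0 < r := hr ▸ div_pos (sub_harvestSum_pos hkj) (sub_τ_pos hkj)
  intro i hi
  rcases lt_or_ge i m with h | h
  · left
    have := hmin i (hkj.trans hi) h
    rw [le_div_iff₀ (sub_τ_pos (hkj.trans hi))] at this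
    linarith
  · right
    have hE0 : 0 < E := hE ▸ sub_harvestSum_pos (hkj.trans hjm)
    have h1 : B ≤ E * (S.g r / r) := by
      rw [← hB, S.burst_eq hE0 hd]
      exact mul_le_mul_of_nonneg_left (S.rate.ratio_lt hr0 hlt).le hE0.le
    have h2 : r * B ≤ S.g r * E := by
      calc r * B ≤ r * (E * (S.g r / r)) := mul_le_mul_of_nonneg_left h1 hr0.le
        _ = S.g r * E := by field_simp
    have h3 := mul_le_mul_of_nonneg_left (S.harvestSum_strictMono.monotone h) (S.rate.pos hr0).le
    have h4 : r * (S.g r * (S.τ j - S.τ k)) = S.g r * (S.harvestSum j - S.harvestSum k) := by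
      rw [← hrj]; ring
    rw [hE] at h2
    linarith

theorem isLeast_sInf_nat {s : Set ℕ} (hs : s.Nonempty) : IsLeast s (sInf s) :=
  ⟨Nat.sInf_mem hs, fun _ h => Nat.sInf_le h⟩

/-- What the algorithm without receiver constraint does from the instant `τ k` on. -/
theorem MinTime.spec {T : ℝ} {w : ℝ → ℝ} (h : S.MinTime k B T w) (hρ : 0 < ρ) (hB0 : 0 < B)
    (hk : S.KeepsRate k B ρ) :
    S.τ k < T ∧ (∀ D, B ≤ (D - S.τ k) * S.g ρ → T ≤ D) ∧ IsPower (S.τ k) T w ∧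
    ∀ P : Policy, (∀ t ∈ Ico (S.τ k) T, P.power t = w t) →
      P.energyUsed (S.τ k) = S.harvestSum k →
      S.IsTautOn P (S.τ k) T ρ ∧ P.energyUsed T = S.harvestedBefore T ∧
        P.bits S.g T = P.bits S.g (S.τ k) + B := by
  induction h generalizing ρ with
  | last k m B E d hm hE hd hB hle =>
    simp only [harvestedBefore_τ] at hm hE hle
    have hkm : k < m := hm.1.1
    have hE0 : 0 < E := hE ▸ sub_harvestSum_pos hkm
    have hdm : d ≤ S.τ m - S.τ k := by
      refine S.le_of_burst_le hE0 (sub_τ_pos hkm) ?_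
      rw [hB, hE]
      exact hm.1.2
    have hp : 0 < E / d := div_pos hE0 hd
    have hρp : ρ ≤ E / d := by
      rw [hE] at hB ⊢
      exact hk.le_rate hρ hkm hd hB.le hdm
    have hend : S.harvestSum k + E / d * (S.τ k + d - S.τ k) = S.harvestSum m := by
      rw [add_sub_cancel_left, div_mul_cancel₀ _ hd.ne', hE]; ring
    have hline : S.LineFeasible (S.τ k) (S.τ k + d) (S.harvestSum k) (E / d) := by
      rw [S.lineFeasible_iff hp (by linarith) hend]
      intro i hi hki
      rcases (S.τ_strictMono.le_iff_le.1 hki).eq_or_lt with rfl | hki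
      · simp
      · have := hle i hki hi
        rw [le_div_iff₀ (sub_τ_pos hki)] at this
        linarith
    refine ⟨by linarith, fun D hD => ?_, IsPower.const (S.τ_nonneg k) (by linarith) hp.le, ?_⟩
    · have hg : S.g ρ ≤ S.g (E / d) :=
        S.rate.strictMono.monotoneOn (mem_Ici.2 hρ.le) (mem_Ici.2 hp.le) hρp
      have h1 : d * S.g ρ ≤ (D - S.τ k) * S.g ρ :=
        (mul_le_mul_of_nonneg_left hg hd.le).trans (hB.le.trans hD)
      linarith [le_of_mul_le_mul_right h1 (S.rate.pos hρ)]
    · intro P hP hU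
      have hPU := P.energyUsed_sub_of_const (by linarith) hP
      have hPB := P.bits_sub_of_const S.g_zero (by linarith) hP
      rw [add_sub_cancel_left] at hPB hend hPU
      have hUm : P.energyUsed (S.τ k + d) = S.harvestSum m := by linarith
      have htaut := isTautOn_const hP hU hline
      refine ⟨htaut.of_le hρp, le_antisymm (htaut.energy _ ⟨by linarith, le_rfl⟩) ?_, ?_⟩
      -- The end comes no later than `τ m`, so no more than the energy of the first `m` arrivals has
      -- been harvested by then.
      · rw [hUm, harvestedBefore_eq]
        exact S.harvestSum_strictMono.monotone (S.arrivals_le_iff.2 (by linarith))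
      · rw [burst] at hB
        linarith
  | step k m j B E d r T w hm hE hd hB hkj hjm hr hmin hlt _ ih =>
    simp only [harvestedBefore_τ] at hm hE hr hmin
    have hτ := sub_τ_pos (S := S) hkj
    have hr0 : 0 < r := hr ▸ div_pos (sub_harvestSum_pos hkj) hτ
    -- Minimality of `m` shows that bits remain to be sent after `τ j`.
    have hburst : S.burst (S.harvestSum j - S.harvestSum k) (S.τ j - S.τ k) < B := by
      by_contra! hc
      exact absurd (hm.2 ⟨hkj, hc⟩) (not_le.2 hjm)
    have hρr : ρ ≤ r := hr ▸ hk.le_rate hρ hkj hτ hburst.le le_rfl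
    rw [burst, ← hr] at hburst
    have hB' : 0 < B - S.g r * (S.τ j - S.τ k) := by linarith
    obtain ⟨hjT, hD, hpow, hspec⟩ := ih hr0 hB' (keepsRate_step hE hd hB hkj hjm hr hmin hlt)
    have hrj : r * (S.τ j - S.τ k) = S.harvestSum j - S.harvestSum k := by
      rw [hr, div_mul_cancel₀ _ hτ.ne']
    have hline : S.LineFeasible (S.τ k) (S.τ j) (S.harvestSum k) r := by
      rw [S.lineFeasible_iff (K := j) hr0 (by linarith) (by linarith)]
      intro i hi hki
      rcases (S.τ_strictMono.le_iff_le.1 hki).eq_or_lt with rfl | hki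
      · simp
      · have := hmin i hki (hi.trans hjm)
        rw [le_div_iff₀ (sub_τ_pos hki)] at this
        linarith
    refine ⟨by linarith, fun D hBD => hD D ?_, ?_, ?_⟩
    · have hg : S.g ρ ≤ S.g r :=
        S.rate.strictMono.monotoneOn (mem_Ici.2 hρ.le) (mem_Ici.2 hr0.le) hρr
      have hpos : 0 < D - S.τ k := pos_of_mul_pos_left (hB0.trans_le hBD) (S.rate.pos hρ).le
      have := mul_le_mul_of_nonneg_left hg hpos.le
      linarith
    · exact (IsPower.const (S.τ_nonneg k) (by linarith) hr0.le).ite_lt hpow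
    · intro P hP hU
      have hleft : ∀ t ∈ Ico (S.τ k) (S.τ j), P.power t = r := fun t ht =>
        (hP t ⟨ht.1, ht.2.trans hjT⟩).trans (if_pos ht.2)
      have hPU := P.energyUsed_sub_of_const (by linarith) hleft
      have hPB := P.bits_sub_of_const S.g_zero (by linarith) hleft
      have hUj : P.energyUsed (S.τ j) = S.harvestSum j := by linarith
      obtain ⟨h1, h2, h3⟩ := hspec P (fun t ht =>
        (hP t ⟨by linarith [ht.1], ht.2⟩).trans (if_neg (not_lt.2 ht.1))) hUj
      refine ⟨?_, h2, by linarith⟩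
      exact ((isTautOn_const hleft hU hline).glue h1 le_rfl (fun t ht => (hleft t ht).le)
        hUj).of_le hρr

/-- The time `D`, by which the guaranteed power would send the remaining bits, remains a valid bound
at each recursive call, because the guaranteed power only grows. Thus `τ k` stays before `D`, and
the induction is on a bound for the number of arrivals from `τ k` up to `D`. -/
theorem exists_minTime {D : ℝ} (hρ : 0 < ρ) (hB0 : 0 < B) (hk : S.KeepsRate k B ρ)
    (hD : B ≤ (D - S.τ k) * S.g ρ) : ∃ T w, S.MinTime k B T w := by
  obtain ⟨N, hN⟩ : ∃ N, S.arrivals D ≤ k + N := ⟨S.arrivals D, by omega⟩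
  induction N generalizing k B ρ with
  | zero =>
    have h1 : 0 < D - S.τ k := pos_of_mul_pos_left (hB0.trans_le hD) (S.rate.pos hρ).le
    have := S.arrivals_le_iff.1 hN
    rw [add_zero] at this
    linarith
  | succ N ih =>
    have hDk : 0 < D - S.τ k := pos_of_mul_pos_left (hB0.trans_le hD) (S.rate.pos hρ).le
    have hne : {i | k < i ∧ B ≤ S.burst (S.harvestedBefore (S.τ i) - S.harvestedBefore (S.τ k))
        (S.τ i - S.τ k)}.Nonempty := by
      have hDi := S.le_τ_arrivals D
      have hki : k < S.arrivals D := S.lt_arrivals_iff.2 (by linarith)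
      refine ⟨S.arrivals D, hki, ?_⟩
      -- The first arrival not before `D` belongs to the set that defines `m`: if its energy were
      -- too little for `B` bits, its average rate would be at least `ρ`, and already until `D` this
      -- would send `B` bits.
      set i := S.arrivals D
      rw [harvestedBefore_τ, harvestedBefore_τ]
      by_contra! hlt
      have h1 := hk.le_rate hρ hki (sub_τ_pos hki) hlt.le le_rfl
      have h2 : S.g ρ ≤ S.g ((S.harvestSum i - S.harvestSum k) / (S.τ i - S.τ k)) :=
        S.rate.strictMono.monotoneOn (mem_Ici.2 hρ.le) (mem_Ici.2 (hρ.le.trans h1)) h1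
      have h3 := mul_le_mul (show D - S.τ k ≤ S.τ i - S.τ k by linarith) h2 (S.rate.pos hρ).le
        (sub_τ_pos hki).le
      rw [burst] at hlt
      linarith
    have hm := isLeast_sInf_nat hne
    set m := sInf {i | k < i ∧ B ≤ S.burst (S.harvestedBefore (S.τ i)
      - S.harvestedBefore (S.τ k)) (S.τ i - S.τ k)}
    have hkm : k < m := hm.1.1
    have hE0 : 0 < S.harvestedBefore (S.τ m) - S.harvestedBefore (S.τ k) := by
      rw [harvestedBefore_τ, harvestedBefore_τ]
      exact sub_harvestSum_pos hkm
    obtain ⟨d, hd, -, hdB⟩ := S.exists_burst_eq hE0 hB0 (sub_τ_pos hkm) hm.1.2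
    by_cases hle : ∀ i, k < i → i < m →
        (S.harvestedBefore (S.τ m) - S.harvestedBefore (S.τ k)) / d ≤
          (S.harvestedBefore (S.τ i) - S.harvestedBefore (S.τ k)) / (S.τ i - S.τ k)
    · exact ⟨_, _, MinTime.last k m B _ d hm rfl hd hdB hle⟩
    · push Not at hle
      obtain ⟨i₀, hki₀, hi₀m, hlt⟩ := hle
      obtain ⟨j, hj, hjmin⟩ := Finset.exists_min_image (Finset.Ioo k m)
        (fun i => (S.harvestedBefore (S.τ i) - S.harvestedBefore (S.τ k)) / (S.τ i - S.τ k))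
        ⟨i₀, Finset.mem_Ioo.2 ⟨hki₀, hi₀m⟩⟩
      obtain ⟨hkj, hjm⟩ := Finset.mem_Ioo.1 hj
      have hmin := fun i h1 h2 => hjmin i (Finset.mem_Ioo.2 ⟨h1, h2⟩)
      have hlt' := (hmin i₀ hki₀ hi₀m).trans_lt hlt
      set r := (S.harvestedBefore (S.τ j) - S.harvestedBefore (S.τ k)) / (S.τ j - S.τ k) with hr
      have hτ := sub_τ_pos (S := S) hkj
      have hburst : S.burst (S.harvestSum j - S.harvestSum k) (S.τ j - S.τ k) < B := by
        by_contra! hc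
        refine absurd (hm.2 ⟨hkj, ?_⟩) (not_le.2 hjm)
        rwa [harvestedBefore_τ, harvestedBefore_τ]
      have hr' := hr
      simp only [harvestedBefore_τ] at hr'
      have hρr : ρ ≤ r := hr' ▸ hk.le_rate hρ hkj hτ hburst.le le_rfl
      rw [burst, ← hr'] at hburst
      have hg : S.g ρ ≤ S.g r :=
        S.rate.strictMono.monotoneOn (mem_Ici.2 hρ.le) (mem_Ici.2 (hρ.le.trans hρr)) hρr
      have hBD := mul_le_mul_of_nonneg_left hg hDk.le
      have hstep : S.KeepsRate j (B - S.g r * (S.τ j - S.τ k)) r := by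
        refine keepsRate_step (m := m) rfl hd ?_ hkj hjm hr' ?_ ?_
        · simpa only [harvestedBefore_τ] using hdB
        · simpa only [harvestedBefore_τ] using hmin
        · simpa only [harvestedBefore_τ] using hlt'
      obtain ⟨T, w, hTw⟩ := ih (k := j) (B := B - S.g r * (S.τ j - S.τ k)) (hρ.trans_le hρr)
        (by linarith) hstep (by linarith) (by omega)
      exact ⟨_, _, MinTime.step k m j B _ d r T w hm rfl hd hdB hkj hjm hr hmin hlt' hTw⟩

end MinTime


/-! ### INIT_POLICY and the invariant of the algorithm -/

variable {S : System}

/-- The properties of the current policy that hold throughout the algorithm, where `n` is the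
index found by INIT_POLICY. -/
structure IsCurrent (S : System) (n : ℕ) (P : Policy) : Prop where
  taut : S.IsTaut P
  duration_le : P.duration ≤ S.Γ₀
  touch : ∃ i ≤ n, P.start ≤ S.τ i ∧ S.τ i < P.finish ∧ P.energyUsed (S.τ i) = S.harvestSum i

/-- A line of slope `p` that meets the harvest curve just before arrival `j` starts at `τ j -
harvestSum j / p`. The earliest feasible start is the greatest of these, and the arrival where it
occurs has an empty battery; `j = 0` shows that it is nonnegative. -/
theorem exists_isLeast_start {n : ℕ} {d p : ℝ} (hd : 0 < d) (hp : 0 < p)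
    (hpd : p * d = S.harvestSum (n + 1)) :
    ∃ a, ∃ i ≤ n, IsLeast {t | 0 ≤ t ∧ S.LineFeasible t (t + d) 0 p} a ∧ a ≤ S.τ i ∧
      p * (S.τ i - a) = S.harvestSum i := by
  obtain ⟨i, hi, hmax⟩ := Finset.exists_max_image (Finset.range (n + 1))
    (fun i => S.τ i - S.harvestSum i / p) ⟨0, by simp⟩
  have hpi : p * (S.harvestSum i / p) = S.harvestSum i := mul_div_cancel₀ _ hp.ne'
  have hiff : ∀ t, S.LineFeasible t (t + d) 0 p ↔
      ∀ j < n + 1, t ≤ S.τ j → 0 + p * (S.τ j - t) ≤ S.harvestSum j := fun t =>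
    S.lineFeasible_iff hp (by linarith) (by rw [add_sub_cancel_left, hpd, zero_add])
  have hdiv : 0 ≤ S.harvestSum i / p := div_nonneg (S.harvestSum_nonneg i) hp.le
  refine ⟨S.τ i - S.harvestSum i / p, i, Nat.lt_succ_iff.1 (Finset.mem_range.1 hi),
    ⟨⟨?_, ?_⟩, ?_⟩, by linarith, by rw [sub_sub_cancel, hpi]⟩
  · have := hmax 0 (by simp)
    simpa [S.τ_zero, S.harvestSum_zero] using this
  · rw [hiff]
    intro j hj _
    have h1 := hmax j (Finset.mem_range.2 hj)
    have h2 : p * (S.harvestSum j / p) = S.harvestSum j := mul_div_cancel₀ _ hp.ne'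
    have h3 := mul_le_mul_of_nonneg_left h1 hp.le
    linarith
  · rintro t ⟨-, ht⟩
    rw [hiff] at ht
    by_contra! hc
    have h1 := ht i (Finset.mem_range.1 hi) (by linarith)
    have h2 := mul_lt_mul_of_pos_left hc hp
    linarith

/-- Jensen's inequality through a supporting line: a feasible policy sends no more bits than its
energy budget spread evenly over the full time `Γ₀`. The budget includes one arrival more than
needed, which keeps it positive. -/
theorem exists_isLeast_burst (hS : ∃ P, S.IsFeasible P) :
    ∃ n, IsLeast {i | S.B₀ ≤ S.burst (S.harvestedUpTo i) S.Γ₀} n := by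
  obtain ⟨P, hP⟩ := hS
  refine ⟨_, isLeast_sInf_nat ⟨S.arrivals P.finish, ?_⟩⟩
  rw [mem_ofPred_eq, harvestedUpTo_eq]
  set K := S.arrivals P.finish with hK
  have hE : 0 < S.harvestSum (K + 1) := S.harvestSum_pos K.succ_pos
  have hΓ := S.Γ₀_pos
  have hp : 0 < S.harvestSum (K + 1) / S.Γ₀ := by positivity
  have hfin : 0 ≤ P.finish := P.start_nonneg.trans P.start_le_finish
  have h := P.bits_sub_le S.g_zero (fun q hq => S.rate.le_support hp hq) P.start_le_finish
  rw [P.bits_of_le_start _ le_rfl, P.energyUsed_of_le_start le_rfl, hP.bits_eq,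
    P.onTime_eq_total, P.total_of_le_start _ le_rfl, ← P.onTime_eq_total] at h
  have h1 := hP.receiver _ ⟨hfin, le_rfl⟩
  have h2 := (hP.energy _ ⟨hfin, le_rfl⟩)
  rw [harvestedBefore_eq, ← hK] at h2
  have h2' := h2.trans (S.harvestSum_strictMono K.lt_succ_self).le
  have h3 := mul_le_mul_of_nonneg_left h1 (S.rate.supportIntercept_nonneg hp)
  have h4 := mul_le_mul_of_nonneg_left h2' (S.rate.supportSlope_nonneg hp)
  have h5 : S.burst (S.harvestSum (K + 1)) S.Γ₀
      = supportIntercept S.g (S.harvestSum (K + 1) / S.Γ₀) * S.Γ₀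
        + supportSlope S.g (S.harvestSum (K + 1) / S.Γ₀) * S.harvestSum (K + 1) := by
    rw [burst, supportIntercept]
    field_simp
    ring
  linarith

/-- Arrivals up to `a + d` lie on or above the line of slope `p`. By any later arrival at least the
energy of the whole line has been harvested, which pays for the remaining bits at power `p`. -/
theorem keepsRate_init {q : ℕ} {a d p : ℝ} (hp : 0 < p)
    (hline : S.LineFeasible a (a + d) 0 p) (haq : a ≤ S.τ q)
    (hq : p * (S.τ q - a) = S.harvestSum q) (hqd : S.τ q < a + d) :
    S.KeepsRate q ((a + d - S.τ q) * S.g p) p := by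
  intro i hi
  have hqi := S.τ_strictMono hi
  rcases le_total (S.τ i) (a + d) with h | h
  · left
    have h1 := hline (S.τ i) ⟨by linarith, h⟩
    rw [harvestedBefore_τ] at h1
    linarith
  · right
    have h1 := hline (a + d) ⟨by linarith, le_rfl⟩
    have h2 := S.harvestedBefore_mono h
    rw [harvestedBefore_τ] at h2
    have h3 : p * (a + d - S.τ q) ≤ S.harvestSum i - S.harvestSum q := by linarith
    have h4 := mul_le_mul_of_nonneg_left h3 (S.rate.pos hp).le
    linarith

/-- The quantities computed by INIT_POLICY. -/
theorem init_data {n q : ℕ} {d pc a : ℝ} (hd : 0 < d)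
    (hB : S.burst (S.harvestedUpTo n) d = S.B₀) (hpc : pc = S.harvestedUpTo n / d)
    (ha : IsLeast {t | 0 ≤ t ∧ S.LineFeasible t (t + d) 0 pc} a)
    (hq : IsLeast {i | S.τ i ∈ Icc a (a + d) ∧ pc * (S.τ i - a) = S.harvestedBefore (S.τ i)} q) :
    0 < pc ∧ q ≤ n ∧ a ≤ S.τ q ∧ S.τ q < a + d ∧ pc * (S.τ q - a) = S.harvestSum q ∧
      d * S.g pc = S.B₀ := by
  rw [harvestedUpTo_eq] at hB hpc
  have hpos : 0 < pc := hpc ▸ div_pos (S.harvestSum_pos n.succ_pos) hd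
  have hpd : pc * d = S.harvestSum (n + 1) := by rw [hpc, div_mul_cancel₀ _ hd.ne']
  obtain ⟨a', i, hin, ha', hai, hi⟩ := exists_isLeast_start hd hpos hpd
  obtain rfl := ha.unique ha'
  have hend : 0 + pc * (a + d - a) = S.harvestSum (n + 1) := by
    rw [add_sub_cancel_left, hpd, zero_add]
  have hlt : ∀ j ≤ n, S.τ j < a + d := fun j hj =>
    S.τ_lt_of_lineFeasible (by linarith) hend ha.1.2 (Nat.lt_succ_of_le hj)
  have hqi : q ≤ i := hq.2 ⟨⟨hai, (hlt i hin).le⟩, by rw [hi, harvestedBefore_τ]⟩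
  refine ⟨hpos, hqi.trans hin, hq.1.1.1, hlt q (hqi.trans hin), ?_, ?_⟩
  · rw [hq.1.2, harvestedBefore_τ]
  · rw [← hB, burst, hpc]

theorem exists_isInit (hS : ∃ P, S.IsFeasible P) : ∃ P, S.IsInit P := by
  obtain ⟨n, hn⟩ := exists_isLeast_burst hS
  have hE : 0 < S.harvestedUpTo n := S.harvestSum_pos n.succ_pos
  obtain ⟨d, hd, -, hB⟩ := S.exists_burst_eq hE S.B₀_pos S.Γ₀_pos hn.1
  have hpc : 0 < S.harvestedUpTo n / d := div_pos hE hd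
  have hpd : S.harvestedUpTo n / d * d = S.harvestSum (n + 1) := div_mul_cancel₀ _ hd.ne'
  obtain ⟨a, i, hin, ha, hai, hi⟩ := exists_isLeast_start hd hpc hpd
  have hend : 0 + S.harvestedUpTo n / d * (a + d - a) = S.harvestSum (n + 1) := by
    rw [add_sub_cancel_left, hpd, zero_add]
  have hq := isLeast_sInf_nat (s := {i | S.τ i ∈ Icc a (a + d) ∧
    S.harvestedUpTo n / d * (S.τ i - a) = S.harvestedBefore (S.τ i)}) ⟨i, ⟨⟨hai,
      (S.τ_lt_of_lineFeasible (by linarith) hend ha.1.2 (Nat.lt_succ_of_le hin)).le⟩,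
      by rw [hi, harvestedBefore_τ]⟩⟩
  set q := sInf {i | S.τ i ∈ Icc a (a + d) ∧
    S.harvestedUpTo n / d * (S.τ i - a) = S.harvestedBefore (S.τ i)}
  obtain ⟨-, hqn, haq, hqd, hqU, hdB⟩ := init_data hd hB rfl ha hq
  have hle := ha.1.2 (a + d) ⟨by linarith, le_rfl⟩
  rw [add_sub_cancel_left, zero_add] at hle
  rcases hle.eq_or_lt with heq | hlt
  · obtain ⟨P, h1, h2, h3⟩ := IsPower.const ha.1.1 (show a ≤ a + d by linarith) hpc.le
    exact ⟨P, n, q, d, _, a, hn, hd, hB, rfl, ha, hq, h1, Or.inl ⟨heq, h2, h3⟩⟩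
  · have hrate := keepsRate_init hpc ha.1.2 haq hqU hqd
    have hB0 : 0 < (a + d - S.τ q) * S.g (S.harvestedUpTo n / d) :=
      mul_pos (by linarith) (S.rate.pos hpc)
    obtain ⟨T, w, hTw⟩ := exists_minTime (D := a + d) hpc hB0 hrate le_rfl
    obtain ⟨-, -, hpow, -⟩ := hTw.spec hpc hB0 hrate
    obtain ⟨P, h1, h2, h3⟩ := (IsPower.const ha.1.1 haq hpc.le).ite_lt hpow
    exact ⟨P, n, q, d, _, a, hn, hd, hB, rfl, ha, hq, h1, Or.inr ⟨hlt, T, w, hTw, h2, h3⟩⟩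

/-- After `τ q` the power never falls below `pc`, so the policy ends by `a + d` and lasts at most `d
≤ Γ₀`. The minimality of `n` is recorded because it later prevents an iteration from removing the
last arrival with empty battery. -/
theorem IsInit.isCurrent {P : Policy} (hP : S.IsInit P) :
    ∃ n, (∀ i < n, S.burst (S.harvestSum (i + 1)) S.Γ₀ < S.B₀) ∧ S.IsCurrent n P := by
  obtain ⟨n, q, d, pc, a, hn, hd, hB, hpc, ha, hq, hstart, hcase⟩ := hP
  obtain ⟨hpos, hqn, haq, hqd, hqU, hdB⟩ := init_data hd hB hpc ha hq
  refine ⟨n, fun i hi => ?_, ?_⟩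
  · by_contra! hc
    exact absurd (hn.2 hc) (not_le.2 hi)
  have hdΓ : d ≤ S.Γ₀ := by
    refine S.le_of_burst_le (S.harvestSum_pos n.succ_pos) S.Γ₀_pos ?_
    rw [← harvestedUpTo_eq, hB]
    exact hn.1
  have hleftU : (∀ t ∈ Ico a (S.τ q), P.power t = pc) → P.energyUsed (S.τ q) = S.harvestSum q := by
    intro h
    have := P.energyUsed_sub_of_const haq h
    rw [P.energyUsed_of_le_start hstart.ge] at this
    linarith
  rcases hcase with ⟨hend, hfin, hpow⟩ | ⟨hlt, T, w, hTw, hfin, hpow⟩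
  · have hU := P.energyUsed_sub_of_const (by linarith) hpow
    have hBits := P.bits_sub_of_const S.g_zero (by linarith) hpow
    rw [P.energyUsed_of_le_start hstart.ge, add_sub_cancel_left] at hU
    rw [P.bits_of_le_start _ hstart.ge, add_sub_cancel_left] at hBits
    have htaut := isTautOn_const hpow (P.energyUsed_of_le_start hstart.ge) ha.1.2
    refine ⟨IsTautOn.isTaut (by rwa [hstart, hfin]) hpos (by linarith) ?_ ?_, ?_, q, hqn, ?_, ?_,
      ?_⟩
    · rw [hfin]; linarith
    · rw [hfin]; linarith
    · rw [Policy.duration]; linarith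
    · rwa [hstart]
    · rwa [hfin]
    · exact hleftU fun t ht => hpow t ⟨ht.1, ht.2.trans hqd⟩
  · have hrate := keepsRate_init hpos ha.1.2 haq hqU hqd
    obtain ⟨hqT, hD, -, hspec⟩ := hTw.spec hpos (mul_pos (by linarith) (S.rate.pos hpos)) hrate
    have hTd := hD (a + d) le_rfl
    have hleft : ∀ t ∈ Ico a (S.τ q), P.power t = pc := fun t ht => by
      rw [hpow t ⟨ht.1, ht.2.trans hqT⟩, if_pos ht.2]
    have hUq := hleftU hleft
    have hBq := P.bits_sub_of_const S.g_zero haq hleft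
    rw [P.bits_of_le_start _ hstart.ge] at hBq
    obtain ⟨h1, h2, h3⟩ := hspec P (fun t ht => by
      rw [hpow t ⟨haq.trans ht.1, ht.2⟩, if_neg (not_lt.2 ht.1)]) hUq
    have hline : S.LineFeasible a (S.τ q) 0 pc := fun t ht =>
      ha.1.2 t ⟨ht.1, ht.2.trans hqd.le⟩
    have htaut := (isTautOn_const hleft (P.energyUsed_of_le_start hstart.ge) hline).glue h1 le_rfl
      (fun t ht => (hleft t ht).le) hUq
    refine ⟨IsTautOn.isTaut (by rwa [hstart, hfin]) hpos (by linarith) ?_ ?_, ?_, q, hqn, ?_, ?_,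
      hUq⟩
    · rw [hfin, h2]
    · rw [hfin]; linarith
    · rw [Policy.duration]; linarith
    · rwa [hstart]
    · rwa [hfin]


/-! ### The two ends of a taut policy and their replacement -/

variable {S : System} {P Q : Policy} {l r : ℕ} {p₁ p₂ : ℝ}

/-- The shape of a policy before its first and after its last instant at which no energy is left. -/
structure HasEnds (S : System) (P : Policy) (l r : ℕ) (p₁ p₂ : ℝ) : Prop where
  start_lt : P.start < S.τ l
  le : l ≤ r
  lt_finish : S.τ r < P.finish
  energyUsed_left : P.energyUsed (S.τ l) = S.harvestSum l
  energyUsed_right : P.energyUsed (S.τ r) = S.harvestSum r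
  power_left : ∀ t ∈ Ico P.start (S.τ l), P.power t = p₁
  power_right : ∀ t ∈ Ico (S.τ r) P.finish, P.power t = p₂
  pos : 0 < p₁
  powers_le : p₁ ≤ p₂
  left_energy : p₁ * (S.τ l - P.start) = S.harvestSum l
  right_energy : p₂ * (P.finish - S.τ r) = S.rightEnergy P r
  left_lt : ∀ i < l, S.harvestSum l - S.harvestSum i < p₁ * (S.τ l - S.τ i)
  right_lt : ∀ i, r < i → S.τ i < P.finish →
    p₂ * (S.τ i - S.τ r) < S.harvestSum i - S.harvestSum r
  outerBits_eq : S.outerBits P l r = S.burst (S.harvestSum l) (S.τ l - P.start)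
    + S.burst (S.rightEnergy P r) (P.finish - S.τ r)

theorem τ_lt_iff {i : ℕ} {t : ℝ} : S.τ i < t ↔ i < S.arrivals t := S.lt_arrivals_iff.symm

/-- The power changes only at arrivals with empty battery, so it is constant before the first and
after the last of them. For the same reason the energy inequalities at the other arrivals there are
strict, which is the room that an iteration exploits. -/
theorem IsTaut.hasEnds (hP : S.IsTaut P) (h0 : 0 < P.start) (hl : IsLeast (S.touching P) l)
    (hr : IsGreatest (S.touching P) r) :
    S.HasEnds P l r (P.power P.start) (P.power (S.τ r)) := by
  obtain ⟨⟨hl1, hl2, hl3⟩, hlmin⟩ := hl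
  obtain ⟨⟨hr1, hr2, hr3⟩, hrmax⟩ := hr
  rw [harvestedBefore_τ] at hl3 hr3
  have ha : P.start ∈ Ico P.start P.finish := ⟨le_rfl, hP.start_lt⟩
  have hrm : S.τ r ∈ Ico P.start P.finish := ⟨hr1.le, hr2⟩
  have hleft : ∀ t ∈ Ico P.start (S.τ l), P.power t = P.power P.start := fun t ht =>
    hP.power_eq_of_no_touch ha ⟨ht.1, ht.2.trans hl2⟩ ht.1 fun i h1 h2 h3 =>
      absurd (hlmin ⟨h1, (h2.trans_lt ht.2).trans hl2, by rw [h3, harvestedBefore_τ]⟩)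
        (not_le.2 (S.τ_strictMono.lt_iff_lt.1 (h2.trans_lt ht.2)))
  have hright : ∀ t ∈ Ico (S.τ r) P.finish, P.power t = P.power (S.τ r) := fun t ht =>
    hP.power_eq_of_no_touch hrm ⟨hr1.le.trans ht.1, ht.2⟩ ht.1 fun i h1 h2 h3 =>
      absurd (hrmax ⟨hr1.trans h1, h2.trans_lt ht.2, by rw [h3, harvestedBefore_τ]⟩)
        (not_le.2 (S.τ_strictMono.lt_iff_lt.1 h1))
  have hp := hP.pos _ ha
  have hUl := P.energyUsed_sub_of_const hl1.le hleft
  rw [hl3, P.energyUsed_of_le_start le_rfl, sub_zero] at hUl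
  have hUr := P.energyUsed_sub_of_const hr2.le hright
  rw [hr3, hP.energy_finish, ← S.harvestedBefore_τ, ← rightEnergy] at hUr
  have hBl := P.bits_sub_of_const S.g_zero hl1.le hleft
  rw [P.bits_of_le_start _ le_rfl, sub_zero] at hBl
  have hBr := P.bits_sub_of_const S.g_zero hr2.le hright
  refine ⟨hl1, hlmin ⟨hr1, hr2, by rw [hr3, harvestedBefore_τ]⟩, hr2, hl3, hr3, hleft, hright, hp,
    hP.mono ha hrm hr1.le, hUl.symm, hUr.symm, fun i hi => ?_, fun i hi hi2 => ?_, ?_⟩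
  · have hil := S.τ_strictMono hi
    have hstrict : P.power P.start * (S.τ i - P.start) < S.harvestSum i := by
      rcases lt_or_ge P.start (S.τ i) with h | h
      · have hU := P.energyUsed_sub_of_const h.le fun x hx => hleft x ⟨hx.1, hx.2.trans hil⟩
        rw [P.energyUsed_of_le_start le_rfl, sub_zero] at hU
        have hle := hP.energy (S.τ i) ⟨h.le, (hil.trans hl2).le⟩
        rw [← hU, ← S.harvestedBefore_τ]
        refine lt_of_le_of_ne hle fun heq => ?_
        exact absurd (hlmin ⟨h, hil.trans hl2, heq⟩) (not_le.2 hi)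
      · rcases Nat.eq_zero_or_pos i with rfl | hi0
        -- A positive start is essential here: a start at 0 would give equality.
        · rw [S.τ_zero, S.harvestSum_zero]
          exact mul_neg_of_pos_of_neg hp (by linarith)
        · exact (mul_nonpos_of_nonneg_of_nonpos hp.le (by linarith)).trans_lt
            (S.harvestSum_pos hi0)
    linarith
  · have hri := S.τ_strictMono hi
    have hU := P.energyUsed_sub_of_const hri.le fun x hx => hright x ⟨hx.1, hx.2.trans hi2⟩
    rw [hr3] at hU
    have hle := hP.energy (S.τ i) ⟨(hr1.trans hri).le, hi2.le⟩
    rw [← hU, ← S.harvestedBefore_τ i]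
    refine sub_lt_sub_right (lt_of_le_of_ne hle fun heq => ?_) _
    exact absurd (hrmax ⟨hr1.trans hri, hi2, heq⟩) (not_le.2 hi)
  · rw [outerBits, hBl, hBr, hUl, hUr, burst_mul _ (by linarith), burst_mul _ (by linarith)]
    ring

namespace HasEnds

variable (h : S.HasEnds P l r p₁ p₂)
include h

theorem l_pos : 0 < l := by
  rcases Nat.eq_zero_or_pos l with rfl | h0
  · have := h.start_lt
    rw [S.τ_zero] at this
    linarith [P.start_nonneg]
  · exact h0

theorem r_lt : r < S.arrivals P.finish := τ_lt_iff.1 h.lt_finish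

theorem rightEnergy_pos : 0 < S.rightEnergy P r := by
  rw [rightEnergy_eq]
  exact sub_harvestSum_pos h.r_lt

theorem leftEnergy_pos : 0 < S.harvestSum l := S.harvestSum_pos h.l_pos

/-- In the form energy times bits per unit of energy, keeping the bits becomes a trade between the
values of `g x / x` at the two powers. -/
theorem outerBits_ratio : S.outerBits P l r
    = S.harvestSum l * (S.g p₁ / p₁) + S.rightEnergy P r * (S.g p₂ / p₂) := by
  have h1 := h.start_lt
  have h2 := h.lt_finish
  have h3 := h.pos.trans_le h.powers_le
  rw [h.outerBits_eq, ← h.left_energy, ← h.right_energy, burst_mul _ (by linarith),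
    burst_mul _ (by linarith)]
  have := h.pos
  field_simp

/-- Feasibility of the part before `τ l`. -/
theorem firstFeasible_iff {p : ℝ} : S.FirstFeasible l p ↔
    0 < p ∧ ∀ i < l, S.harvestSum l - S.harvestSum i ≤ p * (S.τ l - S.τ i) := by
  rw [FirstFeasible, leftEnergy_eq]
  refine and_congr_right fun hp => ?_
  have hpa : p * (S.harvestSum l / p) = S.harvestSum l := mul_div_cancel₀ _ hp.ne'
  have hdiv : 0 < S.harvestSum l / p := div_pos h.leftEnergy_pos hp
  rw [S.lineFeasible_iff (K := l) hp (by linarith) (by rw [sub_sub_cancel, hpa, zero_add])]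
  constructor
  · rintro ⟨-, h2⟩ i hi
    rcases le_or_gt (S.τ l - S.harvestSum l / p) (S.τ i) with h3 | h3
    · linarith [h2 i hi h3]
    · have := mul_lt_mul_of_pos_left h3 hp
      linarith [S.harvestSum_nonneg i]
  · intro h2
    refine ⟨?_, fun i hi _ => by linarith [h2 i hi]⟩
    -- The constraint at arrival 0 says exactly that the start is nonnegative.
    have h3 := h2 0 h.l_pos
    rw [S.τ_zero, S.harvestSum_zero, sub_zero, sub_zero] at h3
    rw [sub_nonneg, div_le_iff₀ hp]
    linarith

theorem firstFeasible_mono {p q : ℝ} (hp : S.FirstFeasible l p) (hpq : p ≤ q) :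
    S.FirstFeasible l q := by
  rw [h.firstFeasible_iff] at hp ⊢
  exact ⟨hp.1.trans_le hpq, fun i hi => (hp.2 i hi).trans
    (mul_le_mul_of_nonneg_right hpq (sub_τ_pos hi).le)⟩

/-- The least power is the greatest average harvesting rate from an earlier arrival up to `τ l`. It
lies below `p₁` because the inequalities before `τ l` are strict; the arrival that attains it will
have an empty battery, or is arrival 0 and the start becomes 0. -/
theorem exists_isLeast_firstFeasible : ∃ p, IsLeast {p | S.FirstFeasible l p} p ∧ p < p₁ ∧
    ∃ i < l, S.harvestSum l - S.harvestSum i = p * (S.τ l - S.τ i) := by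
  obtain ⟨i, hi, hmax⟩ := Finset.exists_max_image (Finset.range l)
    (fun i => (S.harvestSum l - S.harvestSum i) / (S.τ l - S.τ i))
    ⟨0, Finset.mem_range.2 h.l_pos⟩
  rw [Finset.mem_range] at hi
  have hτ := sub_τ_pos (S := S) hi
  refine ⟨_, ⟨?_, fun q hq => ?_⟩, ?_, i, hi, (div_mul_cancel₀ _ hτ.ne').symm⟩
  · rw [mem_ofPred_eq, h.firstFeasible_iff]
    refine ⟨div_pos (sub_harvestSum_pos hi) hτ, fun j hj => ?_⟩
    have := hmax j (Finset.mem_range.2 hj)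
    rwa [div_le_iff₀ (sub_τ_pos hj)] at this
  · rw [mem_ofPred_eq, h.firstFeasible_iff] at hq
    rw [div_le_iff₀ hτ]
    exact hq.2 i hi
  · rw [div_lt_iff₀ hτ]
    exact h.left_lt i hi

/-- Feasibility of the part after `τ r`. -/
theorem lineFeasible_right_iff {p : ℝ} (hp : 0 < p) :
    S.LineFeasible (S.τ r) (S.τ r + S.rightEnergy P r / p) (S.harvestSum r) p ↔
      ∀ i, r < i → S.τ i < P.finish →
        p * (S.τ i - S.τ r) ≤ S.harvestSum i - S.harvestSum r := by
  have hdiv := div_pos h.rightEnergy_pos hp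
  rw [S.lineFeasible_iff (K := S.arrivals P.finish) hp (by linarith) (by
    rw [add_sub_cancel_left, mul_div_cancel₀ _ hp.ne', rightEnergy_eq]; ring)]
  constructor
  · intro h2 i hi hif
    linarith [h2 i (τ_lt_iff.1 hif) (S.τ_strictMono hi).le]
  · intro h2 i hi hri
    rcases (S.τ_strictMono.le_iff_le.1 hri).eq_or_lt with rfl | hri
    · simp
    · linarith [h2 i hri (τ_lt_iff.2 hi)]

/-- The greatest power is the least average harvesting rate from `τ r` to an arrival before the end;
the arrival that attains it becomes one with empty battery. -/
theorem exists_isGreatest_right (harr : ∃ i, r < i ∧ S.τ i < P.finish) :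
    ∃ p, IsGreatest {p | 0 < p ∧ S.LineFeasible (S.τ r) (S.τ r + S.rightEnergy P r / p)
      (S.harvestedBefore (S.τ r)) p} p ∧ p₂ < p ∧
      ∃ i, r < i ∧ S.τ i < P.finish ∧ p * (S.τ i - S.τ r) = S.harvestSum i - S.harvestSum r := by
  obtain ⟨i₀, hri₀, hi₀⟩ := harr
  obtain ⟨i, hi, hmin⟩ := Finset.exists_min_image (Finset.Ioo r (S.arrivals P.finish))
    (fun i => (S.harvestSum i - S.harvestSum r) / (S.τ i - S.τ r))
    ⟨i₀, Finset.mem_Ioo.2 ⟨hri₀, τ_lt_iff.1 hi₀⟩⟩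
  obtain ⟨hri, hif⟩ := Finset.mem_Ioo.1 hi
  have hτ := sub_τ_pos (S := S) hri
  have hpos : 0 < (S.harvestSum i - S.harvestSum r) / (S.τ i - S.τ r) :=
    div_pos (sub_harvestSum_pos hri) hτ
  rw [harvestedBefore_τ]
  refine ⟨_, ⟨⟨hpos, ?_⟩, fun q hq => ?_⟩, ?_, i, hri, τ_lt_iff.2 hif, div_mul_cancel₀ _ hτ.ne'⟩
  · rw [h.lineFeasible_right_iff hpos]
    intro j hrj hjf
    have := hmin j (Finset.mem_Ioo.2 ⟨hrj, τ_lt_iff.1 hjf⟩)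
    rwa [le_div_iff₀ (sub_τ_pos hrj)] at this
  · have h2 := (h.lineFeasible_right_iff hq.1).1 hq.2
    rw [le_div_iff₀ hτ]
    exact h2 i hri (τ_lt_iff.2 hif)
  · rw [lt_div_iff₀ hτ]
    exact h.right_lt i hri (τ_lt_iff.2 hif)

theorem exists_isSplice {a pl pr b : ℝ} (ha : 0 ≤ a) (hal : a ≤ S.τ l) (hb : S.τ r ≤ b)
    (hpl : 0 ≤ pl) (hpr : 0 ≤ pr) : ∃ Q, S.IsSplice P l r a pl pr b Q := by
  have hlr := S.τ_strictMono.monotone h.le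
  have hmid : IsPower (S.τ l) (S.τ r) P.power :=
    IsPower.restrict ⟨P, rfl, rfl, fun _ _ => rfl⟩ h.start_lt.le hlr h.lt_finish.le
  exact (IsPower.const ha hal hpl).ite_lt
    (hmid.ite_lt (IsPower.const (S.τ_nonneg r) hb hpr))

/-- The first power goes down and the last one up, so the power stays monotone, and the used energy
at `τ l` and `τ r` is unchanged, so rises there remain legitimate. The bound on `pr` is asked only
for a nonempty last part, which admits `b = τ r`. -/
theorem splice {a pl pr b : ℝ} (hP : S.IsTaut P) (hQ : S.IsSplice P l r a pl pr b Q)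
    (ha : a < S.τ l) (hpl : 0 < pl) (hpl₁ : pl ≤ p₁)
    (hUl : pl * (S.τ l - a) = S.harvestSum l) (hlinel : S.LineFeasible a (S.τ l) 0 pl)
    (hb : S.τ r ≤ b) (hpr : S.τ r < b → p₂ ≤ pr)
    (hliner : S.LineFeasible (S.τ r) b (S.harvestSum r) pr)
    (hUr : S.harvestSum r + pr * (b - S.τ r) = S.harvestedBefore b)
    (hbits : S.g pl * (S.τ l - a) + S.g pr * (b - S.τ r) = S.outerBits P l r) :
    S.IsTaut Q ∧ (∀ t ∈ Icc a (S.τ l), Q.energyUsed t = pl * (t - a)) ∧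
      ∀ t ∈ Icc (S.τ r) b, Q.energyUsed t = S.harvestSum r + pr * (t - S.τ r) := by
  obtain ⟨hQa, hQb, hpow⟩ := hQ
  have hlr := S.τ_strictMono.monotone h.le
  have hleft : ∀ t ∈ Ico a (S.τ l), Q.power t = pl := fun t ht => by
    rw [hpow t ⟨ht.1, by linarith [ht.2]⟩, if_pos ht.2]
  have hmid : ∀ t ∈ Ico (S.τ l) (S.τ r), Q.power t = P.power t := fun t ht => by
    rw [hpow t ⟨ha.le.trans ht.1, by linarith [ht.2]⟩, if_neg (not_lt.2 ht.1), if_pos ht.2]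
  have hright : ∀ t ∈ Ico (S.τ r) b, Q.power t = pr := fun t ht => by
    rw [hpow t ⟨by linarith [ht.1], ht.2⟩, if_neg (not_lt.2 (hlr.trans ht.1)),
      if_neg (not_lt.2 ht.1)]
  have hU1 : ∀ t ∈ Icc a (S.τ l), Q.energyUsed t = pl * (t - a) := fun t ht => by
    have := Q.energyUsed_sub_of_const ht.1 fun x hx => hleft x ⟨hx.1, hx.2.trans_le ht.2⟩
    rwa [Q.energyUsed_of_le_start hQa.ge, sub_zero] at this
  have hUl' : Q.energyUsed (S.τ l) = P.energyUsed (S.τ l) := by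
    rw [hU1 _ ⟨ha.le, le_rfl⟩, hUl, h.energyUsed_left]
  have hUr' : Q.energyUsed (S.τ r) = S.harvestSum r := by
    rw [IsTautOn.energyUsed_congr hmid hUl' ⟨hlr, le_rfl⟩, h.energyUsed_right]
  have hU2 : ∀ t ∈ Icc (S.τ r) b, Q.energyUsed t = S.harvestSum r + pr * (t - S.τ r) :=
    fun t ht => by
      have := Q.energyUsed_sub_of_const ht.1 fun x hx => hright x ⟨hx.1, hx.2.trans_le ht.2⟩
      linarith
  refine ⟨?_, hU1, hU2⟩
  have hB1 := Q.bits_sub_of_const S.g_zero ha.le hleft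
  rw [Q.bits_of_le_start _ hQa.ge] at hB1
  have hB2 : Q.bits S.g (S.τ r) - Q.bits S.g (S.τ l) = P.bits S.g (S.τ r) - P.bits S.g (S.τ l) :=
    P.total_sub_congr S.g_zero hlr hmid
  have hB3 := Q.bits_sub_of_const S.g_zero hb hright
  have ht1 : S.IsTautOn Q a (S.τ l) pl :=
    isTautOn_const hleft (Q.energyUsed_of_le_start hQa.ge) hlinel
  have ht2 : S.IsTautOn Q (S.τ l) (S.τ r) (P.power (S.τ l)) :=
    (hP.isTautOn h.start_lt.le h.lt_finish.le).congr hmid hUl'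
  have ht3 : S.IsTautOn Q (S.τ r) b p₂ := by
    have h3 := isTautOn_const hright hUr' hliner
    refine { h3 with lb := fun t ht => ?_ }
    rw [hright t ht]
    exact hpr (ht.1.trans_lt ht.2)
  have hml : S.τ l ∈ Ico P.start P.finish := ⟨h.start_lt.le, hlr.trans_lt h.lt_finish⟩
  have hmr : S.τ r ∈ Ico P.start P.finish := ⟨h.start_lt.le.trans hlr, h.lt_finish⟩
  have hma : P.start ∈ Ico P.start P.finish := ⟨le_rfl, hP.start_lt⟩
  have hp2 : P.power (S.τ r) = p₂ := h.power_right _ ⟨le_rfl, h.lt_finish⟩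
  have hp1 : P.power P.start = p₁ := h.power_left _ ⟨le_rfl, h.start_lt⟩
  have hple : pl ≤ P.power (S.τ l) :=
    hpl₁.trans (hp1 ▸ hP.mono hma hml h.start_lt.le)
  have ht23 := ht2.glue ht3 (hp2 ▸ hP.mono hml hmr hlr) (fun t ht => by
    rw [hmid t ht, ← hp2]
    exact hP.mono ⟨h.start_lt.le.trans ht.1, ht.2.trans h.lt_finish⟩ hmr ht.2.le) hUr'
  have ht := ht1.glue ht23 hple (fun t ht => by rw [hleft t ht]; exact hple)
    (by rw [hUl', h.energyUsed_left])
  refine IsTautOn.isTaut (by rwa [hQa, hQb]) hpl (by rw [hQa, hQb]; linarith) ?_ ?_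
  · rw [hQb, hU2 b ⟨hb, le_rfl⟩, hUr]
  · have := hP.bits_finish
    rw [outerBits] at hbits
    rw [hQb]
    linarith

end HasEnds


/-! ### Iterations of PULL_BACK -/

variable {S : System} {P Q : Policy} {l r n : ℕ} {p₁ p₂ : ℝ}

/-- What is common to both kinds of iterations, from `P` to `P'`. -/
structure IsMove (S : System) (P P' : Policy) (l r : ℕ) (pl pr b : ℝ) : Prop where
  first : S.FirstFeasible l pl
  lt_first : pl < P.power P.start
  last : b = S.τ r ∧ pr = 0 ∨ 0 < pr ∧ b = S.τ r + S.rightEnergy P r / pr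
  lt_finish : b < P.finish
  -- Made for QUIT, whose last power ends between `b` and the end of `P`.
  feasible : ∀ p, 0 < p → b ≤ S.τ r + S.rightEnergy P r / p →
    S.LineFeasible (S.τ r) (S.τ r + S.rightEnergy P r / p) (S.harvestSum r) p
  bits : S.g pl * (S.harvestSum l / pl) + S.g pr * (b - S.τ r) = S.outerBits P l r
  isSplice : S.IsSplice P l r (S.τ l - S.harvestSum l / pl) pl pr b P'
  -- The tail is removed, or a constraint after `τ r` becomes tight, or one before `τ l` does.
  progress : b = S.τ r ∨
    (∃ i, r < i ∧ S.τ i < P.finish ∧ pr * (S.τ i - S.τ r) = S.harvestSum i - S.harvestSum r) ∨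
    ∃ i < l, S.harvestSum l - S.harvestSum i = pl * (S.τ l - S.τ i)

theorem compensates_iff {pl pr b : ℝ} : S.Compensates P l r pl pr b ↔
    S.harvestSum l * (S.g pl / pl) + S.g pr * (b - S.τ r) = S.outerBits P l r := by
  rw [Compensates, leftEnergy_eq, mul_div_left_comm]

namespace HasEnds

variable (h : S.HasEnds P l r p₁ p₂)
include h

theorem pos_right : 0 < p₂ := h.pos.trans_le h.powers_le

theorem finish_eq : P.finish = S.τ r + S.rightEnergy P r / p₂ := by
  rw [← h.right_energy, mul_div_cancel_left₀ _ h.pos_right.ne']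
  ring

theorem exists_raiseLast : ∃ pr b, S.RaiseLast P r pr b := by
  by_cases harr : ∃ i, r < i ∧ S.τ i < P.finish
  · obtain ⟨p, hp, -⟩ := h.exists_isGreatest_right harr
    exact ⟨_, _, .hit p harr hp⟩
  · push Not at harr
    exact ⟨_, _, .unbounded harr⟩

/-- With a fixed energy, a higher power means an earlier end and fewer bits, and lowering a feasible
power keeps it feasible. So the raised last part is extreme: whatever sends more bits ends no
earlier, and whatever ends no earlier is feasible. -/
theorem raiseLast_spec {pr b : ℝ} (hR : S.RaiseLast P r pr b) :
    (b = S.τ r ∧ pr = 0 ∨ 0 < pr ∧ b = S.τ r + S.rightEnergy P r / pr) ∧ b < P.finish ∧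
    (∀ p, 0 < p → b ≤ S.τ r + S.rightEnergy P r / p →
      S.LineFeasible (S.τ r) (S.τ r + S.rightEnergy P r / p) (S.harvestSum r) p) ∧
    (b = S.τ r ∨ ∃ i, r < i ∧ S.τ i < P.finish ∧
      pr * (S.τ i - S.τ r) = S.harvestSum i - S.harvestSum r) ∧
    0 ≤ S.g pr * (b - S.τ r) ∧
    S.g pr * (b - S.τ r) < S.rightEnergy P r * (S.g p₂ / p₂) ∧
    ∀ p, 0 < p → S.g pr * (b - S.τ r) < S.rightEnergy P r * (S.g p / p) →
      b ≤ S.τ r + S.rightEnergy P r / p := by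
  have hE := h.rightEnergy_pos
  have hp₂ := h.pos_right
  cases hR with
  | hit pr harr hpr =>
    obtain ⟨q, hq, hlt, i, hi⟩ := h.exists_isGreatest_right harr
    obtain rfl := hpr.unique hq
    have hpos : 0 < pr := hpr.1.1
    have heq : S.g pr * (S.τ r + S.rightEnergy P r / pr - S.τ r)
        = S.rightEnergy P r * (S.g pr / pr) := by ring
    refine ⟨Or.inr ⟨hpos, rfl⟩, ?_, fun p hp hb => ?_, Or.inr ⟨i, hi⟩, ?_, ?_, fun p hp hlt => ?_⟩
    · rw [h.finish_eq]
      linarith [div_lt_div_of_pos_left hE hp₂ hlt]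
    · have hle : p ≤ pr := by
        by_contra! hc
        linarith [div_lt_div_of_pos_left hE hpos hc]
      have hfeas := hpr.1.2
      rw [harvestedBefore_τ, h.lineFeasible_right_iff hpos] at hfeas
      rw [h.lineFeasible_right_iff hp]
      exact fun j hj hjf => (mul_le_mul_of_nonneg_right hle (sub_τ_pos hj).le).trans
        (hfeas j hj hjf)
    · rw [heq]
      exact (mul_pos hE (div_pos (S.rate.pos hpos) hpos)).le
    · rw [heq]
      exact mul_lt_mul_of_pos_left (S.rate.ratio_lt hp₂ hlt) hE
    · rw [heq] at hlt
      have hle : p ≤ pr := S.rate.le_of_ratio_le hpos (lt_of_mul_lt_mul_left hlt hE.le).le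
      linarith [div_le_div_of_nonneg_left hE.le hp hle]
  | unbounded harr =>
    refine ⟨Or.inl ⟨rfl, rfl⟩, h.lt_finish, fun p hp _ => ?_, Or.inl rfl, ?_, ?_, fun p hp _ => ?_⟩
    · rw [h.lineFeasible_right_iff hp]
      exact fun i hi hif => absurd (harr i hi) (not_le.2 hif)
    · simp
    · rw [sub_self, mul_zero]
      exact mul_pos hE (div_pos (S.rate.pos hp₂) hp₂)
    · linarith [div_pos hE hp]

/-- A first power that compensates for the raised last power is feasible unless too many bits
have to be sent. -/
theorem exists_compensates {pr b pmin : ℝ} (hR : S.RaiseLast P r pr b)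
    (hmin : S.FirstFeasible l pmin)
    (hle : S.outerBits P l r ≤ S.harvestSum l * (S.g pmin / pmin) + S.g pr * (b - S.τ r)) :
    ∃ p, S.Compensates P l r p pr b ∧ S.FirstFeasible l p := by
  obtain ⟨-, -, -, -, -, hlt, -⟩ := h.raiseLast_spec hR
  have hE := h.leftEnergy_pos
  have hv : 0 < (S.outerBits P l r - S.g pr * (b - S.τ r)) / S.harvestSum l := by
    refine div_pos ?_ hE
    have := mul_pos hE (div_pos (S.rate.pos h.pos) h.pos)
    rw [h.outerBits_ratio]
    linarith
  obtain ⟨q, hq, hqv⟩ := S.rate.exists_ratio_eq hmin.1 hv (by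
    rw [div_le_iff₀ hE]; linarith)
  refine ⟨q, ?_, h.firstFeasible_mono hmin hq⟩
  rw [compensates_iff, hqv, mul_div_cancel₀ _ hE.ne']
  ring

/-- Bits lost on the right must be gained on the left from the same energy, which forces a lower
first power. -/
theorem lt_of_bits {pl R : ℝ}
    (hR : R < S.rightEnergy P r * (S.g p₂ / p₂))
    (hbits : S.harvestSum l * (S.g pl / pl) + R = S.outerBits P l r) : pl < p₁ := by
  by_contra! hc
  have h1 := mul_le_mul_of_nonneg_left (S.rate.ratio_le h.pos hc) h.leftEnergy_pos.le
  rw [h.outerBits_ratio] at hbits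
  linarith

end HasEnds

/-- In the rejecting case, even the least feasible first power together with the raised last part
sends too few bits. The compensating last power therefore sends more than the raised one, ends no
earlier than it, and inherits feasibility. -/
theorem Iteration.isMove {P' : Policy} (hP : S.IsTaut P) (h0 : 0 < P.start)
    (hI : S.Iteration P P') :
    ∃ l r pl pr b, IsLeast (S.touching P) l ∧ IsGreatest (S.touching P) r ∧
      S.IsMove P P' l r pl pr b := by
  cases hI with
  | accept l r pl pr b hl hr hraise hcomp hfeas hQ =>
    have h := hP.hasEnds h0 hl hr
    obtain ⟨h1, h2, h3, h4, h5, h6, h7⟩ := h.raiseLast_spec hraise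
    have hcomp' := hcomp
    rw [compensates_iff] at hcomp'
    rw [Compensates, leftEnergy_eq] at hcomp
    rw [leftEnergy_eq] at hQ
    exact ⟨l, r, pl, pr, b, hl, hr, hfeas, h.lt_of_bits h6 hcomp', h1, h2, h3, hcomp, hQ,
      h4.imp_right Or.inl⟩
  | reject l r pl pr pr₀ b₀ hl hr hraise hinf hpl hpr hcomp hQ =>
    have h := hP.hasEnds h0 hl hr
    have hE := h.rightEnergy_pos
    obtain ⟨h1, h2, h3, h4, h5, h6, h7⟩ := h.raiseLast_spec hraise
    obtain ⟨q, hq, hqlt, i, hi, hqi⟩ := h.exists_isLeast_firstFeasible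
    obtain rfl := hpl.unique hq
    have hcomp' := hcomp
    rw [compensates_iff] at hcomp'
    have heq : S.g pr * (S.τ r + S.rightEnergy P r / pr - S.τ r)
        = S.rightEnergy P r * (S.g pr / pr) := by ring
    rw [heq] at hcomp'
    have hlt : S.g pr₀ * (b₀ - S.τ r) < S.rightEnergy P r * (S.g pr / pr) := by
      by_contra! hc
      exact hinf (h.exists_compensates hraise hpl.1 (by linarith))
    have hb := h7 pr hpr hlt
    -- The lower first power has gained bits, so the last part must lose some.
    have hppr : P.power (S.τ r) < pr := by
      by_contra! hc
      have e1 := mul_le_mul_of_nonneg_left (S.rate.ratio_le hpr hc) hE.le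
      have e2 := mul_lt_mul_of_pos_left (S.rate.ratio_lt hpl.1.1 hqlt) h.leftEnergy_pos
      rw [h.outerBits_ratio] at hcomp'
      linarith
    rw [Compensates, leftEnergy_eq] at hcomp
    rw [leftEnergy_eq] at hQ
    refine ⟨l, r, pl, pr, _, hl, hr, hpl.1, hqlt, Or.inr ⟨hpr, rfl⟩, ?_,
      fun p hp hbp => h3 p hp (hb.trans hbp), hcomp, hQ, Or.inr (Or.inr ⟨i, hi, hqi⟩)⟩
    rw [h.finish_eq]
    linarith [div_lt_div_of_pos_left hE h.pos_right hppr]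

/-- If no compensating first power is feasible, the least feasible one is used. The bits then left
for the last part are positive but fewer than `P` sends there, so a higher last power achieves them.
-/
theorem exists_iteration (hP : S.IsTaut P) (h0 : 0 < P.start)
    (hl : IsLeast (S.touching P) l) (hr : IsGreatest (S.touching P) r) :
    ∃ P', S.Iteration P P' := by
  have h := hP.hasEnds h0 hl hr
  have hE := h.rightEnergy_pos
  obtain ⟨pr₀, b₀, hraise⟩ := h.exists_raiseLast
  obtain ⟨h1, h2, h3, h4, h5, h6, h7⟩ := h.raiseLast_spec hraise
  have hal : ∀ {p}, 0 < p → S.τ l - S.leftEnergy l / p ≤ S.τ l := fun hp => by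
    rw [leftEnergy_eq]
    linarith [div_pos h.leftEnergy_pos hp]
  by_cases hc : ∃ p, S.Compensates P l r p pr₀ b₀ ∧ S.FirstFeasible l p
  · obtain ⟨p, hcomp, hfeas⟩ := hc
    have hb : S.τ r ≤ b₀ ∧ 0 ≤ pr₀ := by
      rcases h1 with ⟨e1, e2⟩ | ⟨e1, e2⟩
      · exact ⟨e1.ge, e2.ge⟩
      · exact ⟨by rw [e2]; linarith [div_pos hE e1], e1.le⟩
    obtain ⟨Q, hQ⟩ := h.exists_isSplice hfeas.2.1 (hal hfeas.1) hb.1 hfeas.1.le hb.2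
    exact ⟨Q, .accept l r p pr₀ b₀ hl hr hraise hcomp hfeas hQ⟩
  · obtain ⟨pl, hpl, hlt, -⟩ := h.exists_isLeast_firstFeasible
    have hgt : S.harvestSum l * (S.g pl / pl) + S.g pr₀ * (b₀ - S.τ r) < S.outerBits P l r := by
      by_contra! hle
      exact hc (h.exists_compensates hraise hpl.1 hle)
    have hv : 0 < (S.outerBits P l r - S.harvestSum l * (S.g pl / pl)) / S.rightEnergy P r :=
      div_pos (by linarith) hE
    obtain ⟨pr, hpr, hprv⟩ := S.rate.exists_ratio_eq h.pos_right hv (by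
      rw [div_le_iff₀ hE]
      have := mul_lt_mul_of_pos_left (S.rate.ratio_lt hpl.1.1 hlt) h.leftEnergy_pos
      rw [h.outerBits_ratio]
      linarith)
    have hpr0 : 0 < pr := h.pos_right.trans_le hpr
    have hcomp : S.Compensates P l r pl pr (S.τ r + S.rightEnergy P r / pr) := by
      rw [compensates_iff, add_sub_cancel_left, mul_div_left_comm (S.g pr), hprv,
        mul_div_cancel₀ _ hE.ne']
      ring
    obtain ⟨Q, hQ⟩ := h.exists_isSplice hpl.1.2.1 (hal hpl.1.1)
      (show S.τ r ≤ S.τ r + S.rightEnergy P r / pr by linarith [div_pos hE hpr0])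
      hpl.1.1.le hpr0.le
    exact ⟨Q, .reject l r pl pr pr₀ b₀ hl hr hraise hc hpl hpr0 hcomp hQ⟩

namespace IsMove

variable {P' : Policy} {pl pr b : ℝ} (hM : S.IsMove P P' l r pl pr b)
include hM

theorem le_end (h : S.HasEnds P l r p₁ p₂) : S.τ r ≤ b := by
  rcases hM.last with ⟨e1, -⟩ | ⟨e1, e2⟩
  · exact e1.ge
  · rw [e2]; linarith [div_pos h.rightEnergy_pos e1]

/-- The new policy has the properties of the old one. -/
theorem spec (hP : S.IsTaut P) (h : S.HasEnds P l r (P.power P.start) (P.power (S.τ r))) :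
    S.IsTaut P' ∧ (∀ t ∈ Icc (S.τ l - S.harvestSum l / pl) (S.τ l),
      P'.energyUsed t = pl * (t - (S.τ l - S.harvestSum l / pl))) ∧
    (∀ t ∈ Icc (S.τ r) b, P'.energyUsed t = S.harvestSum r + pr * (t - S.τ r)) ∧
    (S.τ r < b → S.arrivals b = S.arrivals P.finish) := by
  have hE := h.rightEnergy_pos
  obtain ⟨hpl, -, hlinel⟩ := hM.first
  rw [leftEnergy_eq] at hlinel
  have hcancel : S.τ l - (S.τ l - S.harvestSum l / pl) = S.harvestSum l / pl := sub_sub_cancel _ _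
  have hright : (S.τ r < b → P.power (S.τ r) ≤ pr) ∧
      S.LineFeasible (S.τ r) b (S.harvestSum r) pr ∧
      S.harvestSum r + pr * (b - S.τ r) = S.harvestedBefore b ∧
      (S.τ r < b → S.arrivals b = S.arrivals P.finish) := by
    rcases hM.last with ⟨rfl, rfl⟩ | ⟨e1, e2⟩
    · refine ⟨fun hlt => absurd hlt (lt_irrefl _), fun t ht => ?_, ?_, fun hlt =>
        absurd hlt (lt_irrefl _)⟩
      · rw [zero_mul, add_zero, ← harvestedBefore_τ]
        exact S.harvestedBefore_mono ht.1
      · rw [zero_mul, add_zero, ← harvestedBefore_τ]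
    · have hline := hM.feasible pr e1 e2.le
      rw [← e2] at hline
      have hrb : S.τ r ≤ b := hM.le_end h
      have hend : S.harvestSum r + pr * (b - S.τ r) = S.harvestSum (S.arrivals P.finish) := by
        rw [e2, add_sub_cancel_left, mul_div_cancel₀ _ e1.ne', rightEnergy_eq]
        ring
      -- By `b` the energy of all arrivals before the old end has been used, so they all precede
      -- `b`.
      have harr : S.arrivals b = S.arrivals P.finish := by
        refine le_antisymm (S.arrivals_mono hM.lt_finish.le) ?_
        have := hline b ⟨hrb, le_rfl⟩
        rw [hend, harvestedBefore_eq] at this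
        exact S.harvestSum_strictMono.le_iff_le.1 this
      refine ⟨fun hlt => ?_, hline, by rw [hend, harvestedBefore_eq, harr], fun _ => harr⟩
      by_contra! hc
      have h1 := div_lt_div_of_pos_left hE e1 hc
      have h2 := hM.lt_finish
      rw [h.finish_eq] at h2
      linarith
  have hs := h.splice hP hM.isSplice (by linarith [div_pos h.leftEnergy_pos hpl]) hpl
    hM.lt_first.le (by rw [hcancel, mul_div_cancel₀ _ hpl.ne']) hlinel (hM.le_end h) hright.1
    hright.2.1 hright.2.2.1 (by rw [hcancel]; exact hM.bits)
  exact ⟨hs.1, hs.2.1, hs.2.2, hright.2.2.2⟩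

theorem touching_left (hP : S.IsTaut P)
    (h : S.HasEnds P l r (P.power P.start) (P.power (S.τ r))) (hlt : S.τ l < b) :
    l ∈ S.touching P' := by
  obtain ⟨-, h2, -, -⟩ := hM.spec hP h
  obtain ⟨ha, hb, -⟩ := hM.isSplice
  have hpl := hM.first.1
  have hdiv := div_pos h.leftEnergy_pos hpl
  refine ⟨by rw [ha]; linarith, by rwa [hb], ?_⟩
  rw [h2 _ ⟨by linarith, le_rfl⟩, sub_sub_cancel, mul_div_cancel₀ _ hpl.ne', harvestedBefore_τ]

theorem touching_right (hP : S.IsTaut P)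
    (h : S.HasEnds P l r (P.power P.start) (P.power (S.τ r))) {i : ℕ} (hri : r ≤ i)
    (hi : S.τ i < P.finish) (hpr : pr * (S.τ i - S.τ r) = S.harvestSum i - S.harvestSum r)
    (hlt : S.τ r < b) : i ∈ S.touching P' := by
  obtain ⟨-, -, h3, h4⟩ := hM.spec hP h
  obtain ⟨ha, hb, -⟩ := hM.isSplice
  have hib : S.τ i < b := by
    rw [τ_lt_iff, h4 hlt, ← τ_lt_iff]
    exact hi
  have hτ := S.τ_strictMono.monotone hri
  have hlr := S.τ_strictMono.monotone h.le
  refine ⟨?_, by rwa [hb], ?_⟩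
  · rw [ha]
    linarith [div_pos h.leftEnergy_pos hM.first.1]
  · rw [h3 _ ⟨hτ, hib.le⟩, hpr, harvestedBefore_τ]
    ring

end IsMove

/-- The invariant allows the empty battery at the start itself, but with a positive start something
has been harvested and nothing used by then. The arrival is thus strictly inside. -/
theorem exists_isLeast_touching (hP : S.IsCurrent n P) (h0 : 0 < P.start) :
    ∃ l r, IsLeast (S.touching P) l ∧ IsGreatest (S.touching P) r ∧ l ≤ n := by
  obtain ⟨i, hin, hi1, hi2, hi3⟩ := hP.touch
  have hi0 : 0 < i := by
    rcases Nat.eq_zero_or_pos i with rfl | h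
    · rw [S.τ_zero] at hi1
      linarith
    · exact h
  have hne : (S.touching P).Nonempty := by
    refine ⟨i, lt_of_le_of_ne hi1 fun heq => ?_, hi2, by rw [hi3, harvestedBefore_τ]⟩
    rw [← heq, P.energyUsed_of_le_start le_rfl] at hi3
    exact (S.harvestSum_pos hi0).ne hi3
  have hfin : (S.touching P).Finite :=
    (Set.finite_lt_nat (S.arrivals P.finish)).subset fun j hj => S.lt_arrivals_iff.2 hj.2.1
  obtain ⟨r, hr⟩ := hfin.exists_maximal hne
  refine ⟨_, r, isLeast_sInf_nat hne, ⟨hr.1, fun j hj => ?_⟩, ?_⟩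
  · by_contra! hc
    exact absurd (hr.2 hj hc.le) (not_le.2 hc)
  · refine (Nat.sInf_le ?_).trans hin
    refine ⟨lt_of_le_of_ne hi1 fun heq => ?_, hi2, by rw [hi3, harvestedBefore_τ]⟩
    rw [← heq, P.energyUsed_of_le_start le_rfl] at hi3
    exact (S.harvestSum_pos hi0).ne hi3

/-- An iteration preserves the properties of the current policy. -/
theorem IsMove.isCurrent {P' : Policy} {pl pr b : ℝ} (hM : S.IsMove P P' l r pl pr b)
    (hn : ∀ i < n, S.burst (S.harvestSum (i + 1)) S.Γ₀ < S.B₀) (hP : S.IsTaut P)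
    (h : S.HasEnds P l r (P.power P.start) (P.power (S.τ r))) (hln : l ≤ n)
    (hdur : P'.duration ≤ S.Γ₀) : S.IsCurrent n P' := by
  refine ⟨(hM.spec hP h).1, hdur, ?_⟩
  rcases lt_or_ge (S.τ l) b with hlt | hge
  · obtain ⟨h1, h2, h3⟩ := hM.touching_left hP h hlt
    exact ⟨l, hln, h1.le, h2, by rw [h3, harvestedBefore_τ]⟩
  -- Here the tail is removed and `l = r`, so the energy of the first `l` arrivals sends all bits
  -- within `Γ₀`. Since `l - 1 < n`, this contradicts the minimality of `n`.
  · exfalso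
    have hlr := S.τ_strictMono.monotone h.le
    have hbr := hM.le_end h
    have hl : l = r := S.τ_strictMono.injective (by linarith)
    subst hl
    obtain ⟨-, rfl⟩ : b = S.τ l ∧ pr = 0 :=
      hM.last.resolve_right fun e => by
        have := div_pos h.rightEnergy_pos e.1
        linarith [e.2]
    have hb : b = S.τ l := le_antisymm hge hbr
    have hpl := hM.first.1
    have hbits := hM.bits
    rw [S.g_zero, zero_mul, add_zero, outerBits, add_sub_cancel, hP.bits_finish] at hbits
    have hd : S.harvestSum l / pl ≤ S.Γ₀ := by
      rw [Policy.duration, hM.isSplice.1, hM.isSplice.2.1, hb] at hdur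
      linarith
    have hlpos := h.l_pos
    have h1 := hn (l - 1) (by omega)
    rw [Nat.sub_add_cancel hlpos] at h1
    have h2 := S.burst_le h.leftEnergy_pos (div_pos h.leftEnergy_pos hpl) hd
    rw [burst, div_div_cancel₀ h.leftEnergy_pos.ne'] at h2
    linarith

/-- An iteration makes progress. -/
theorem IsMove.rank_lt {P' : Policy} {pl pr b : ℝ} (hM : S.IsMove P P' l r pl pr b)
    (hP : S.IsTaut P) (h : S.HasEnds P l r (P.power P.start) (P.power (S.τ r)))
    (h0 : 0 < P'.start) {l' r' : ℕ} (hl' : IsLeast (S.touching P') l')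
    (hr' : IsGreatest (S.touching P') r') :
    S.arrivals P'.finish * S.arrivals P'.finish + (S.arrivals P'.finish + l' - r') <
      S.arrivals P.finish * S.arrivals P.finish + (S.arrivals P.finish + l - r) := by
  have hlr' : l' ≤ r' := hl'.2 hr'.1
  have hr'K : r' < S.arrivals P'.finish := τ_lt_iff.1 hr'.1.2.1
  have hrK := h.r_lt
  have hlr := h.le
  obtain ⟨-, hspec, -, harr⟩ := hM.spec hP h
  obtain ⟨ha, hfin, -⟩ := hM.isSplice
  -- The rank is `K² + (K + l - r)` with `K` the number of arrivals before the end. Removing the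
  -- tail lowers `K` to `r`, and the second summand is at most `K`, so the drop of the square
  -- dominates. Otherwise `K` stays and the second summand drops.
  rcases (hM.le_end h).eq_or_lt with hb | hb
  · have hK : S.arrivals P'.finish = r := by rw [hfin, ← hb, arrivals_τ]
    rw [hK] at hr'K ⊢
    have h1 : r + l' - r' ≤ r := by omega
    have h2 : (r + 1) * (r + 1) ≤ S.arrivals P.finish * S.arrivals P.finish :=
      Nat.mul_le_mul hrK hrK
    nlinarith
  · have hτlr := S.τ_strictMono.monotone hlr
    rw [hfin, harr hb] at hr'K ⊢
    have hl'l : l' ≤ l := hl'.2 (hM.touching_left hP h (hτlr.trans_lt hb))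
    have hrr' : r ≤ r' := hr'.2 (hM.touching_right hP h le_rfl h.lt_finish (by simp) hb)
    -- The tight constraint of the iteration is a new arrival with empty battery before `τ l` or
    -- after `τ r`.
    have key : l' < l ∨ r < r' := by
      rcases hM.progress with e | ⟨i, hri, hif, hi⟩ | ⟨i, hil, hi⟩
      · exact absurd e hb.ne'
      · exact Or.inr (hri.trans_le (hr'.2 (hM.touching_right hP h hri.le hif hi hb)))
      · left
        refine (hl'.2 ?_).trans_lt hil
        have hpl := hM.first.1
        have hplE : pl * (S.harvestSum l / pl) = S.harvestSum l := mul_div_cancel₀ _ hpl.ne'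
        rw [ha] at h0
        have hUi : pl * (S.τ i - (S.τ l - S.harvestSum l / pl)) = S.harvestSum i := by linarith
        have hi0 : 0 < i := by
          -- A tight constraint at arrival 0 would mean a start at 0, which is excluded.
          rcases Nat.eq_zero_or_pos i with rfl | hpos
          · rw [S.τ_zero, S.harvestSum_zero] at hUi
            have := mul_pos hpl h0
            linarith
          · exact hpos
        have hlt : S.τ l - S.harvestSum l / pl < S.τ i := by
          have := S.harvestSum_pos hi0
          rw [← hUi] at this
          linarith [pos_of_mul_pos_right this hpl.le]
        have hτi := S.τ_strictMono hil
        refine ⟨by rwa [ha], by rw [hfin]; linarith, ?_⟩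
        rw [hspec _ ⟨hlt.le, hτi.le⟩, hUi, harvestedBefore_τ]
    omega


/-! ### QUIT, soundness and termination -/

variable {S : System} {P Q : Policy} {l r n : ℕ}

theorem mul_div_eq_burst {E p : ℝ} (hE : E ≠ 0) : S.g p * (E / p) = S.burst E (E / p) := by
  rw [burst, div_div_cancel₀ hE, mul_comm]

/-- QUIT has an output. -/
theorem IsMove.exists_isQuit {P' : Policy} {pl pr b : ℝ} (hM : S.IsMove P P' l r pl pr b)
    (h : S.HasEnds P l r (P.power P.start) (P.power (S.τ r)))
    (hl : IsLeast (S.touching P) l) (hr : IsGreatest (S.touching P) r)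
    (hdur : P.duration < S.Γ₀) (hdur' : S.Γ₀ < P'.duration) : ∃ Q, S.IsQuit P P' Q := by
  have hEl := h.leftEnergy_pos
  have hEr := h.rightEnergy_pos
  have hpl := hM.first.1
  have hrb := hM.le_end h
  have hstart := h.start_lt
  have hbf := hM.lt_finish
  have hfin := h.lt_finish
  obtain ⟨ha, hb, -⟩ := hM.isSplice
  rw [Policy.duration] at hdur hdur'
  rw [ha, hb] at hdur'
  have hdiv := div_pos hEl hpl
  have ha0 : 0 ≤ S.τ l - S.harvestSum l / pl := by
    have := hM.first.2.1
    rwa [leftEnergy_eq] at this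
  -- The bits outside `[τ l, τ r]` when the policy occupies the window of length `Γ₀` that ends at
  -- `y`.
  set F : ℝ → ℝ := fun y => S.burst (S.harvestSum l) (S.τ l - (y - S.Γ₀))
    + S.burst (S.rightEnergy P r) (y - S.τ r) with hF
  have hcont : ContinuousOn F (Icc b P.finish) := by
    refine ContinuousOn.add ((S.burst_continuousOn_Ici hEl).comp (by fun_prop) fun y hy => ?_)
      ((S.burst_continuousOn_Ici hEr).comp (by fun_prop) fun y hy => ?_)
    · exact mem_Ici.2 (by linarith [hy.2])
    · exact mem_Ici.2 (by linarith [hy.1])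
  have hright : S.g pr * (b - S.τ r) = S.burst (S.rightEnergy P r) (b - S.τ r) := by
    rcases hM.last with ⟨rfl, rfl⟩ | ⟨e1, e2⟩
    · rw [sub_self, mul_zero, burst_zero_right]
    · rw [e2, add_sub_cancel_left, mul_div_eq_burst hEr.ne']
  -- At `y = b` the window starts later than `P'`, so bits are missing; at `y = P.finish` it starts
  -- earlier than `P`, so there are too many.
  have hFb : F b < S.outerBits P l r := by
    rw [← hM.bits, hright, mul_div_eq_burst hEl.ne']
    exact add_lt_add_left (S.burst_lt hEl (by linarith) (by linarith)) _
  have hFf : S.outerBits P l r < F P.finish := by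
    rw [h.outerBits_eq]
    exact add_lt_add_left (S.burst_lt hEl (by linarith) (by linarith)) _
  obtain ⟨y, ⟨hby, hyf⟩, hy⟩ := intermediate_value_Icc hbf.le hcont ⟨hFb.le, hFf.le⟩
  have hby' : b < y := lt_of_le_of_ne hby fun e => by
    rw [← e] at hy
    exact hFb.ne hy
  have hx : y - S.Γ₀ < S.τ l := by linarith
  have hx0 : 0 ≤ y - S.Γ₀ := by linarith
  obtain ⟨Q, hQ⟩ := h.exists_isSplice hx0 hx.le (hrb.trans hby)
    (div_pos hEl (sub_pos.2 hx)).le (div_pos hEr (sub_pos.2 (hrb.trans_lt hby'))).le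
  rw [← leftEnergy_eq] at hQ
  refine ⟨Q, l, r, y - S.Γ₀, y, hl, hr, ⟨?_, ?_⟩, ⟨?_, hyf⟩, hrb.trans_lt hby', ?_,
    sub_sub_cancel _ _, hQ⟩
  · rw [ha]; linarith
  · linarith
  · rwa [hb]
  · rw [leftEnergy_eq]
    exact hy

/-- The output of QUIT is optimal. -/
theorem IsMove.isOptimal {P' : Policy} {pl pr b : ℝ} (hM : S.IsMove P P' l r pl pr b)
    (hP : S.IsTaut P) (h : S.HasEnds P l r (P.power P.start) (P.power (S.τ r)))
    (hl : IsLeast (S.touching P) l) (hr : IsGreatest (S.touching P) r)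
    (hQ : S.IsQuit P P' Q) : S.IsOptimal Q := by
  obtain ⟨l₁, r₁, x, y, hl₁, hr₁, hx, hy, hry, hbits, hΓ, hsplice⟩ := hQ
  obtain rfl := hl₁.unique hl
  obtain rfl := hr₁.unique hr
  obtain ⟨ha, hb, -⟩ := hM.isSplice
  rw [ha] at hx
  rw [hb] at hy
  rw [leftEnergy_eq] at hbits hsplice
  have hEl := h.leftEnergy_pos
  have hEr := h.rightEnergy_pos
  have hpl := hM.first.1
  have hxl : x < S.τ l₁ := hx.2.trans_lt h.start_lt
  have hxpos : 0 < S.τ l₁ - x := sub_pos.2 hxl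
  have hypos : 0 < y - S.τ r₁ := sub_pos.2 hry
  have hdl : S.harvestSum l₁ / (S.harvestSum l₁ / (S.τ l₁ - x)) = S.τ l₁ - x :=
    div_div_cancel₀ hEl.ne'
  have hdr : S.rightEnergy P r₁ / (S.rightEnergy P r₁ / (y - S.τ r₁)) = y - S.τ r₁ :=
    div_div_cancel₀ hEr.ne'
  have hppos : 0 < S.harvestSum l₁ / (S.τ l₁ - x) := div_pos hEl hxpos
  have hqpos : 0 < S.rightEnergy P r₁ / (y - S.τ r₁) := div_pos hEr hypos
  have hmulr : S.rightEnergy P r₁ / (y - S.τ r₁) * (y - S.τ r₁) = S.rightEnergy P r₁ :=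
    div_mul_cancel₀ _ hypos.ne'
  -- The new start is not before that of `P'`, so the first power is at least the feasible `pl`;
  -- likewise the end is not before `b`, which makes the last power feasible.
  have hple : pl ≤ S.harvestSum l₁ / (S.τ l₁ - x) := by
    rw [le_div_iff₀ hxpos]
    calc pl * (S.τ l₁ - x) ≤ pl * (S.harvestSum l₁ / pl) :=
          mul_le_mul_of_nonneg_left (by linarith [hx.1]) hpl.le
      _ = _ := mul_div_cancel₀ _ hpl.ne'
  obtain ⟨-, -, hlinel⟩ := h.firstFeasible_mono hM.first hple
  rw [leftEnergy_eq, hdl, sub_sub_cancel] at hlinel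
  have hliner := hM.feasible _ hqpos (by rw [hdr]; linarith [hy.1])
  rw [hdr, add_sub_cancel] at hliner
  have hfinal : S.harvestSum r₁ + S.rightEnergy P r₁ / (y - S.τ r₁) * (y - S.τ r₁)
      = S.harvestedBefore y := by
    have h1 := hliner y ⟨hry.le, le_rfl⟩
    refine le_antisymm h1 ?_
    rw [hmulr, rightEnergy, harvestedBefore_τ, add_sub_cancel]
    exact S.harvestedBefore_mono hy.2
  obtain ⟨hT, hU, -⟩ := h.splice hP hsplice hxl hppos (by
      rw [div_le_iff₀ hxpos, ← h.left_energy]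
      exact mul_le_mul_of_nonneg_left (by linarith [hx.2]) h.pos.le)
    (div_mul_cancel₀ _ hxpos.ne') hlinel hry.le (fun _ => by
      rw [le_div_iff₀ hypos, ← h.right_energy]
      exact mul_le_mul_of_nonneg_left (by linarith [hy.2]) h.pos_right.le) hliner hfinal (by
      rw [← hbits, burst, burst]; ring)
  have hdur : Q.duration = S.Γ₀ := by
    rw [Policy.duration, hsplice.1, hsplice.2.1, hΓ]
  refine hT.isOptimal ⟨l₁, ?_, ?_, ?_⟩ hdur.le (Or.inr hdur)
  · rw [hsplice.1]; exact hxl.le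
  · rw [hsplice.2.1]; exact (S.τ_strictMono.monotone h.le).trans_lt hry
  · rw [hU _ ⟨hxl.le, le_rfl⟩, div_mul_cancel₀ _ hxpos.ne']

/-- A policy that stops PULL_BACK within the time of the receiver is optimal. -/
theorem IsCurrent.isOptimal (hP : S.IsCurrent n P) (hT : S.Terminated P) : S.IsOptimal P := by
  obtain ⟨i, -, hi⟩ := hP.touch
  refine hP.taut.isOptimal ⟨i, hi⟩ hP.duration_le ?_
  rcases hT with h | h
  exacts [Or.inr (le_antisymm hP.duration_le h), Or.inl h]

theorem start_pos_of_not_terminated (hT : ¬ S.Terminated P) : 0 < P.start :=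
  lt_of_le_of_ne P.start_nonneg fun h => hT (Or.inr h.symm)

theorem duration_lt_of_not_terminated (hT : ¬ S.Terminated P) : P.duration < S.Γ₀ :=
  lt_of_not_ge fun h => hT (Or.inl h)

theorem IsCurrent.exists_isMove (hP : S.IsCurrent n P) (hT : ¬ S.Terminated P) {P' : Policy}
    (hI : S.Iteration P P') : ∃ l r pl pr b, l ≤ n ∧ IsLeast (S.touching P) l ∧
      IsGreatest (S.touching P) r ∧ S.HasEnds P l r (P.power P.start) (P.power (S.τ r)) ∧
      S.IsMove P P' l r pl pr b := by
  have h0 := start_pos_of_not_terminated hT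
  obtain ⟨l, r, pl, pr, b, hl, hr, hM⟩ := hI.isMove hP.taut h0
  obtain ⟨l₁, -, hl₁, -, hln⟩ := exists_isLeast_touching hP h0
  obtain rfl := hl₁.unique hl
  exact ⟨l₁, r, pl, pr, b, hln, hl, hr, hP.taut.hasEnds h0 hl hr, hM⟩

theorem IsCurrent.exists_step (hP : S.IsCurrent n P) : ∃ y, S.Step (.running P) y := by
  by_cases hT : S.Terminated P
  · exact ⟨_, .accept P hT hP.duration_le⟩
  have h0 := start_pos_of_not_terminated hT
  obtain ⟨l, r, hl, hr, -⟩ := exists_isLeast_touching hP h0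
  obtain ⟨P', hI⟩ := exists_iteration hP.taut h0 hl hr
  rcases le_or_gt P'.duration S.Γ₀ with hd | hd
  · exact ⟨_, .iterate P P' hT hI hd⟩
  obtain ⟨l, r, pl, pr, b, -, hl, hr, h, hM⟩ := hP.exists_isMove hT hI
  obtain ⟨Q, hQ⟩ := hM.exists_isQuit h hl hr (duration_lt_of_not_terminated hT) hd
  exact ⟨_, .quit P P' Q hT hI hd hQ⟩

/-- The invariant of the algorithm. -/
def State.IsSound (S : System) (n : ℕ) : State → Prop
  | .running P => S.IsCurrent n P
  | .output Q => S.IsOptimal Q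

theorem Step.isSound (hn : ∀ i < n, S.burst (S.harvestSum (i + 1)) S.Γ₀ < S.B₀) {x y : State}
    (h : S.Step x y) (hx : x.IsSound S n) : y.IsSound S n := by
  cases h with
  | accept P hT hd => exact IsCurrent.isOptimal hx hT
  | iterate P P' hT hI hd =>
    obtain ⟨l, r, pl, pr, b, hln, hl, hr, h, hM⟩ := IsCurrent.exists_isMove hx hT hI
    exact hM.isCurrent hn (IsCurrent.taut hx) h hln hd
  | quit P P' Q hT hI hd hQ =>
    obtain ⟨l, r, pl, pr, b, hln, hl, hr, h, hM⟩ := IsCurrent.exists_isMove hx hT hI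
    exact hM.isOptimal (IsCurrent.taut hx) h hl hr hQ

theorem acc_output (Q : Policy) : Acc (fun x y => S.Step y x) (State.output Q) :=
  ⟨_, fun _ h => nomatch h⟩

/-- Induction on a bound for the rank. The bound is asked only for a positive start: from a start at
0 the policy is terminated, no iteration is possible, and outputs have no successor. -/
theorem IsCurrent.acc (hn : ∀ i < n, S.burst (S.harvestSum (i + 1)) S.Γ₀ < S.B₀)
    (hP : S.IsCurrent n P) : Acc (fun x y => S.Step y x) (State.running P) := by
  suffices H : ∀ N, ∀ P : Policy, S.IsCurrent n P → (0 < P.start →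
      ∀ l r, IsLeast (S.touching P) l → IsGreatest (S.touching P) r →
        S.arrivals P.finish * S.arrivals P.finish + (S.arrivals P.finish + l - r) < N) →
      Acc (fun x y => S.Step y x) (State.running P) by
    by_cases h0 : 0 < P.start
    · obtain ⟨l, r, hl, hr, -⟩ := exists_isLeast_touching hP h0
      refine H (S.arrivals P.finish * S.arrivals P.finish + (S.arrivals P.finish + l - r) + 1) P hP
        fun _ l' r' hl' hr' => ?_
      rw [hl'.unique hl, hr'.unique hr]
      exact Nat.lt_succ_self _
    · exact H 0 P hP fun h => absurd h h0
  intro N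
  induction N with
  | zero =>
    intro P hP hN
    refine ⟨_, fun y hy => ?_⟩
    cases hy with
    | accept _ hT hd => exact acc_output P
    | iterate _ P' hT hI hd =>
      have h0 := start_pos_of_not_terminated hT
      obtain ⟨l, r, hl, hr, -⟩ := exists_isLeast_touching hP h0
      exact absurd (hN h0 l r hl hr) (Nat.not_lt_zero _)
    | quit _ P' Q hT hI hd hQ => exact acc_output Q
  | succ N ih =>
    intro P hP hN
    refine ⟨_, fun y hy => ?_⟩
    cases hy with
    | accept _ hT hd => exact acc_output P
    | iterate _ P' hT hI hd =>
      have h0 := start_pos_of_not_terminated hT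
      obtain ⟨l, r, pl, pr, b, hln, hl, hr, h, hM⟩ := hP.exists_isMove hT hI
      refine ih P' (hM.isCurrent hn hP.taut h hln hd) fun h0' l' r' hl' hr' => ?_
      have h1 := hM.rank_lt hP.taut h h0' hl' hr'
      have h2 := hN h0 l r hl hr
      omega
    | quit _ P' Q hT hI hd hQ => exact acc_output Q

end System

end EnergyHarvest

/-- If the finish-time minimization problem has a feasible policy, then INIT_POLICY has an output,
and every run of `OFF` from such an output is finite, never gets stuck, and can only end with the
output of an optimal policy. -/
theorem theorem3 (S : EnergyHarvest.System)
    (hS : ∃ P : EnergyHarvest.Policy, S.IsFeasible P) :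
    (∃ P₀ : EnergyHarvest.Policy, S.IsInit P₀) ∧
    ∀ P₀ : EnergyHarvest.Policy, S.IsInit P₀ →
      Acc (fun x y => S.Step y x) (EnergyHarvest.System.State.running P₀) ∧
      ∀ x : EnergyHarvest.System.State,
        Relation.ReflTransGen S.Step (EnergyHarvest.System.State.running P₀) x →
        (∃ y, S.Step x y) ∨
          ∃ P : EnergyHarvest.Policy, x = EnergyHarvest.System.State.output P ∧ S.IsOptimal P := by
  refine ⟨EnergyHarvest.System.exists_isInit hS, fun P₀ hP₀ => ?_⟩
  obtain ⟨n, hn, hP⟩ := hP₀.isCurrent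
  refine ⟨hP.acc hn, fun x hx => ?_⟩
  have hsound : x.IsSound S n := by
    induction hx with
    | refl => exact hP
    | tail _ hstep ih => exact hstep.isSound hn ih
  cases x with
  | running P => exact Or.inl (EnergyHarvest.System.IsCurrent.exists_step hsound)
  | output Q => exact Or.inr ⟨Q, rfl, hsound⟩
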